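/- **Notation.** Let $\mathbf x=(x_1,x_2,\dots)$, $\mathbf t=(t_1,t_2,\dots)$. For $f\in\mathbb Z[\mathbf t][\mathbf x]$ and $i\ge 1$ put $$R_i^-f=f(x_1,\dots,x_{i-1},t_i,x_i,x_{i+1},\dots;\mathbf t),\qquad R_i^+f=f(x_1,\dots,x_{i-1},x_i,t_i,x_{i+1},\dots;\mathbf t),\qquad E_if=\frac{R_i^+f-R_i^-f}{x_i-t_i}.$$ $\mathrm{EQSym}_n$ is the set of $f\in\mathbb Z[\mathbf t][x_1,\dots,x_n]$ with $R_i^+f=R_i^-f$ for $1\le i<n$. For a permutation $\sigma$ of $\{1,2,\dots\}$ fixing all but finitely many elements, $\mathrm{ev}_\sigma f=f(t_{\sigma(1)},t_{\sigma(2)},\dots;\mathbf t)\in\mathbb Z[\mathbf t]$. A set partition of $[n]=\{1,\dots,n\}$ is noncrossing if there are no distinct blocks $A,B$ with $a,b\in A$, $c,d\in B$ and $a<c<b<d$. $\mathrm{NC}_n\subset S_n$ is the set of noncrossing permutations, i.e. the products, over the blocks $\{a_p>\dots>a_1\}$ of a noncrossing partition of $[n]$, of the backwards cycles $(a_p\,a_{p-1}\cdots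 a_1)$. An indexed forest $F=(T_1,T_2,\dots)$ is a sequence of finite plane binary trees (each node has $0$ or $2$ children), all but finitely many of which are a single leaf; its leaves are labelled $1,2,\dots$ from left to right, and $\emptyset$ is the forest of single leaves. For an internal node $v$ let $\rho(v)$ be the leaf reached from $v$ along left edges. The code of $F$ is $c(F)=(c_1,c_2,\dots)$ with $c_i=|\{v:\rho(v)=i\}|$. Let $\mathrm{qdes}(F)=\{\rho(v): \text{both children of } v\text{ are leaves}\}$ and, for $i\in\mathrm{qdes}(F)$, let $F/i$ be $F$ with the node $v$ with leaf children and $\rho(v)=i$ replaced by a leaf. The double forest polynomials are the family of homogeneous polynomials $P_F(\mathbf x;\mathbf t)\in\mathbb Z[\mathbf t][\mathbf x]$, indexed by the indexed forests, determined by $$P_F(\mathbf t;\mathbf t)=\begin{cases}1&F=\emptyset\\0&F\neq\emptyset\end{cases}\qquad\text{and}\qquad E_iP_F=\begin{cases}P_{F/i}(\mathbf x;t_1,\dots,t_{i-1},t_{i+1},\dots)&i\in\mathrm{qdes}(F)\\0&i\notin\mathrm{qdes}(F)\end{cases}\quad(i\ge1).$$ For a padded composition $c=(0^{n-\ell},a_1,\dots,a_\ell)$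 of length $n$ (all $a_j>0$), the double fundamental quasisymmetric polynomial is $\mathfrak F_c=P_{F_c}$, where $F_c$ is the indexed forest with code $(c,0,0,\dots)$. It is $1$ if $c=0^n$; the nonconstant ones are those with $c\ne 0^n$. **Theorem.** Let $n\ge0$. 1. If $f\in\mathrm{EQSym}_n$ and $\sigma\in\mathrm{NC}_n$, then $\mathrm{ev}_\sigma f=\mathrm{ev}_{\mathrm{id}}f$. 2. The double forest polynomials are well defined (there is exactly one family $(P_F)$ as above), and if $c\neq 0^n$ is a padded composition of length $n$, then $\mathrm{ev}_\sigma\mathfrak F_c=0$ for all $\sigma\in\mathrm{NC}_n$. That is, every nonconstant double fundamental quasisymmetric polynomial vanishes at all noncrossing permutations. 3. $\mathrm{NC}_n$ is the class of the identity under the equivalence relation $\sim_{\mathrm{NC}}$ on $S_n$ generated by $\sigma\sim_{\mathrm{NC}}\sigma s_i$ whenever $1\le i<n$ and $i\in\{\sigma(i),\sigma(i+1)\}$, where $s_i=(i,i+1)$. -/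

import Mathlib

/-! Indices start at `0`: the variables `x 0, x 1, …` and `t 0, t 1, …` are usually written `x₁, x₂, …` and
`t₁, t₂, …`, `[n]` is `{0, …, n - 1}`, and leaves, codes and permutations are
shifted by one in the same way. -/

namespace EQSymNC

/-! ### Polynomials in two sets of variables -/

/-- The ring `ℤ[t][x]` of polynomials in the variables `x 0, x 1, …` and `t 0, t 1, …`. -/
abbrev Poly : Type := MvPolynomial (ℕ ⊕ ℕ) ℤ

noncomputable def x (i : ℕ) : Poly := MvPolynomial.X (Sum.inl i)

noncomputable def t (i : ℕ) : Poly := MvPolynomial.X (Sum.inr i)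

/-- `f(x₀, …, x_{i-1}, t_i, x_i, x_{i+1}, …; t)`: put `t_i` in position `i` and move the later
`x`-variables one position to the right. -/
noncomputable def Rminus (i : ℕ) : Poly →ₐ[ℤ] Poly :=
  MvPolynomial.aeval (Sum.elim
    (fun j => if j < i then x j else if j = i then t i else x (j - 1)) t)

/-- `f(x₀, …, x_{i-1}, x_i, t_i, x_{i+1}, …; t)`: put `t_i` in position `i + 1` and move the later
`x`-variables one position to the right. -/
noncomputable def Rplus (i : ℕ) : Poly →ₐ[ℤ] Poly :=
  MvPolynomial.aeval (Sum.elim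
    (fun j => if j < i + 1 then x j else if j = i + 1 then t i else x (j - 1)) t)

/-- The equivariantly quasisymmetric polynomials in `ℤ[t][x₀, …, x_{n-1}]`. -/
def EQSym (n : ℕ) : Set Poly :=
  {f | (∀ j, Sum.inl j ∈ f.vars → j < n) ∧ ∀ i, i + 1 < n → Rplus i f = Rminus i f}

/-- The evaluation `f(x; t) ↦ f(t_{σ(0)}, t_{σ(1)}, …; t)` in `ℤ[t]`. -/
noncomputable def ev (σ : Equiv.Perm ℕ) : Poly →ₐ[ℤ] MvPolynomial ℕ ℤ :=
  MvPolynomial.aeval (Sum.elim (fun j => MvPolynomial.X (σ j)) MvPolynomial.X)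

/-- The substitution `f(x; t) ↦ f(x; t₀, …, t_{i-1}, t_{i+1}, …)`. -/
noncomputable def omitT (i : ℕ) : Poly →ₐ[ℤ] Poly :=
  MvPolynomial.aeval (Sum.elim x (fun j => if j < i then t j else t (j + 1)))

/-- `g` is the equivariant quasisymmetric divided difference
`(R_i⁺ f - R_i⁻ f) / (x_i - t_i)` of `f` (the quotient is unique, as `Poly` is a domain). -/
def IsDividedDifference (i : ℕ) (f g : Poly) : Prop :=
  Rplus i f - Rminus i f = (x i - t i) * g

/-! ### Noncrossing permutations -/

/-- No two distinct blocks contain `a, b` and `c, d`, respectively, with `a < c < b < d`. -/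
def IsNoncrossing {n : ℕ} (P : Finpartition (Finset.range n)) : Prop :=
  ∀ A ∈ P.parts, ∀ B ∈ P.parts, A ≠ B →
    ∀ a ∈ A, ∀ b ∈ A, ∀ c ∈ B, ∀ d ∈ B, ¬ (a < c ∧ c < b ∧ b < d)

/-- On the block `B = {a_p > ⋯ > a_1}` the permutation is the backwards cycle
`a_p ↦ a_{p-1} ↦ ⋯ ↦ a_1 ↦ a_p`: an element goes to the next smaller element of `B`, and the
smallest element goes to the largest one. -/
def IsBackwardsCycleOn (σ : Equiv.Perm ℕ) (B : Finset ℕ) : Prop :=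
  ∀ a ∈ B, IsGreatest {b | b ∈ B ∧ b < a} (σ a) ∨
    (IsLeast (B : Set ℕ) a ∧ IsGreatest (B : Set ℕ) (σ a))

/-- The noncrossing permutations: the products of the backwards cycles on the blocks of a
noncrossing partition of `{0, …, n - 1}`, with `S_n` seen as the group of all permutations of `ℕ`
that fix every `i ≥ n`. -/
def NC (n : ℕ) : Set (Equiv.Perm ℕ) :=
  {σ | (∀ i, n ≤ i → σ i = i) ∧ ∃ P : Finpartition (Finset.range n),
    IsNoncrossing P ∧ ∀ B ∈ P.parts, IsBackwardsCycleOn σ B}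

/-- The generating relations `σ ∼ σ s_i` for `i ∈ {σ(i), σ(i+1)}`. -/
def NCStep (n : ℕ) (σ τ : Equiv.Perm ℕ) : Prop :=
  ∃ i, i + 1 < n ∧ (σ i = i ∨ σ (i + 1) = i) ∧ τ = σ * Equiv.swap i (i + 1)

/-! ### Indexed forests

A binary plane tree is a `BinaryTree Unit`, where `BinaryTree.nil` is the trivial tree (a single leaf). In the
functions on trees below, `a` is the label of the leftmost leaf of the tree. -/

/-- The number of internal nodes `v` with `ρ(v) = i`, where `ρ(v)` is the label of the leaf that is
reached from `v` along left edges. -/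
def treeCode : BinaryTree Unit → ℕ → ℕ → ℕ
  | .nil, _, _ => 0
  | .node _ l r, a, i =>
      (if i = a then 1 else 0) + treeCode l a i + treeCode r (a + l.numLeaves) i

/-- The labels `ρ(v)` of the terminal nodes `v` (both children of `v` are leaves). -/
def treeQDes : BinaryTree Unit → ℕ → Set ℕ
  | .nil, _ => ∅
  | .node _ .nil .nil, a => {a}
  | .node _ l r, a => treeQDes l a ∪ treeQDes r (a + l.numLeaves)

/-- Delete the terminal node `v` with `ρ(v) = i`, if there is one: it becomes a leaf. -/
def treeTrim : BinaryTree Unit → ℕ → ℕ → BinaryTree Unit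
  | .nil, _, _ => .nil
  | .node _ .nil .nil, a, i => if i = a then .nil else .node () .nil .nil
  | .node _ l r, a, i => .node () (treeTrim l a i) (treeTrim r (a + l.numLeaves) i)

/-- An indexed forest: a sequence of binary trees, all but finitely many of them trivial. -/
@[ext]
structure IndexedForest where
  tree : ℕ → BinaryTree Unit
  finite : {j | tree j ≠ .nil}.Finite

namespace IndexedForest

/-- The forest all of whose trees are trivial. -/
def empty : IndexedForest := ⟨fun _ => .nil, by simp⟩

/-- The leaves of a forest are labelled `0, 1, 2, …` from left to right; this is the label of the
leftmost leaf of the tree with index `j`. -/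
def firstLeaf (F : IndexedForest) (j : ℕ) : ℕ := ∑ k ∈ Finset.range j, (F.tree k).numLeaves

/-- The code of a forest. Since `j ≤ F.firstLeaf j`, the trees with index `j > i` do not
contribute to the entry at `i`. -/
def code (F : IndexedForest) (i : ℕ) : ℕ :=
  ∑ j ∈ Finset.range (i + 1), treeCode (F.tree j) (F.firstLeaf j) i

/-- The labels `ρ(v)` of the terminal nodes `v` of the forest. -/
def qdes (F : IndexedForest) : Set ℕ := {i | ∃ j, i ∈ treeQDes (F.tree j) (F.firstLeaf j)}

/-- The trimmed forest `F / i`. -/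
def trim (F : IndexedForest) (i : ℕ) : IndexedForest where
  tree j := treeTrim (F.tree j) (F.firstLeaf j) i
  finite := F.finite.subset fun j hj h => hj (by simp [h, treeTrim])

end IndexedForest

/-! ### Double forest polynomials and double fundamental quasisymmetric polynomials -/

/-- The conditions that define the double forest polynomials: homogeneity, the normalization
`P_F(t; t) = δ_{F, ∅}`, and the recursion `E_i P_F = P_{F / i}(x; t₀, …, t_{i-1}, t_{i+1}, …)` if
`i ∈ qdes F`, `E_i P_F = 0` otherwise. -/
structure IsDoubleForestFamily (P : IndexedForest → Poly) : Prop where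
  homogeneous : ∀ F, ∃ d, (P F).IsHomogeneous d
  ev_empty : ev 1 (P .empty) = 1
  ev_of_ne : ∀ F, F ≠ .empty → ev 1 (P F) = 0
  trim_mem : ∀ F, ∀ i ∈ F.qdes, IsDividedDifference i (P F) (omitT i (P (F.trim i)))
  trim_notMem : ∀ F, ∀ i ∉ F.qdes, IsDividedDifference i (P F) 0

/-- Padded compositions `(0, …, 0, a_1, …, a_l)` of length `n`, with all `a_i > 0`; they are
extended by zeros to infinite sequences. -/
def IsPadded (n : ℕ) (c : ℕ → ℕ) : Prop :=
  ∃ k ≤ n, (∀ i < k, c i = 0) ∧ (∀ i, k ≤ i → i < n → 0 < c i) ∧ ∀ i, n ≤ i → c i = 0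

/-! ### Every finitely supported sequence is the code of a forest -/

theorem treeCode_of_lt (T : BinaryTree Unit) : ∀ a i, i < a → treeCode T a i = 0 := by
  induction T with
  | nil => intros; rfl
  | node _ l r hl hr =>
    intro a i h
    simp [treeCode, hl a i h, hr (a + l.numLeaves) i (by omega), h.ne]

theorem treeCode_succ (T : BinaryTree Unit) :
    ∀ a i, treeCode T (a + 1) (i + 1) = treeCode T a i := by
  induction T with
  | nil => intros; rfl
  | node _ l r hl hr =>
    intro a i
    have h := hr (a + l.numLeaves) i
    rw [show a + l.numLeaves + 1 = a + 1 + l.numLeaves by omega] at h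
    simp [treeCode, hl a i, h]

theorem IndexedForest.le_firstLeaf (F : IndexedForest) (j : ℕ) : j ≤ F.firstLeaf j := by
  have := Finset.card_nsmul_le_sum (Finset.range j) (fun k => (F.tree k).numLeaves) 1
    (fun k _ => (F.tree k).numLeaves_pos)
  simpa [IndexedForest.firstLeaf] using this

/-- A left path with `k` nodes whose right subtrees are `T 0, …, T (k - 1)` from left to right. -/
def spine (T : ℕ → BinaryTree Unit) : ℕ → BinaryTree Unit
  | 0 => .nil
  | k + 1 => .node () (spine T k) (T k)

theorem numLeaves_spine (F : IndexedForest) (k : ℕ) :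
    (spine F.tree k).numLeaves = F.firstLeaf k + 1 := by
  induction k with
  | zero => rfl
  | succ k ih =>
    simp only [IndexedForest.firstLeaf, Finset.sum_range_succ] at ih ⊢
    simp only [spine, BinaryTree.numLeaves]
    omega

theorem treeCode_spine_zero (F : IndexedForest) (k : ℕ) : treeCode (spine F.tree k) 0 0 = k := by
  induction k with
  | zero => rfl
  | succ k ih =>
    rw [spine, treeCode, ih, numLeaves_spine, treeCode_of_lt _ _ _ (by omega)]
    simp [add_comm]

theorem treeCode_spine_succ (F : IndexedForest) (k i : ℕ) :
    treeCode (spine F.tree k) 0 (i + 1) =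
      ∑ j ∈ Finset.range k, treeCode (F.tree j) (F.firstLeaf j) i := by
  induction k with
  | zero => rfl
  | succ k ih =>
    rw [spine, treeCode, ih, numLeaves_spine, Finset.sum_range_succ, zero_add, treeCode_succ]
    simp

/-- Join the first `k` trees of `F` by a left path that starts at a new first leaf. -/
def IndexedForest.cons (k : ℕ) (F : IndexedForest) : IndexedForest where
  tree j := match j with
    | 0 => spine F.tree k
    | j + 1 => F.tree (k + j)
  finite := by
    obtain ⟨N, hN⟩ := F.finite.bddAbove
    refine (Set.finite_Iic (N + 1)).subset fun j hj => ?_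
    cases j with
    | zero => simp
    | succ j => have := hN (show k + j ∈ {j | F.tree j ≠ .nil} from hj); simp; omega

theorem IndexedForest.firstLeaf_cons (k : ℕ) (F : IndexedForest) (j : ℕ) :
    (F.cons k).firstLeaf (j + 1) = F.firstLeaf (k + j) + 1 := by
  induction j with
  | zero => simpa [IndexedForest.firstLeaf, IndexedForest.cons] using numLeaves_spine F k
  | succ j ih =>
    have h1 : (F.cons k).firstLeaf (j + 1 + 1) =
      (F.cons k).firstLeaf (j + 1) + (F.tree (k + j)).numLeaves := Finset.sum_range_succ _ _
    have h2 : F.firstLeaf (k + (j + 1)) = F.firstLeaf (k + j) + (F.tree (k + j)).numLeaves :=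
      Finset.sum_range_succ _ _
    omega

theorem IndexedForest.code_cons_zero (k : ℕ) (F : IndexedForest) : (F.cons k).code 0 = k := by
  simpa [IndexedForest.code, IndexedForest.cons, IndexedForest.firstLeaf] using
    treeCode_spine_zero F k

theorem IndexedForest.code_cons_succ (k : ℕ) (F : IndexedForest) (i : ℕ) :
    (F.cons k).code (i + 1) = F.code i := by
  have h : ∀ j, treeCode ((F.cons k).tree (j + 1)) ((F.cons k).firstLeaf (j + 1)) (i + 1) =
      treeCode (F.tree (k + j)) (F.firstLeaf (k + j)) i := fun j => by
    rw [IndexedForest.firstLeaf_cons, treeCode_succ]; rfl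
  rw [IndexedForest.code, Finset.sum_range_succ', Finset.sum_congr rfl (fun j _ => h j)]
  have h0 : treeCode ((F.cons k).tree 0) ((F.cons k).firstLeaf 0) (i + 1) = _ :=
    treeCode_spine_succ F k i
  rw [h0, add_comm, ← Finset.sum_range_add, IndexedForest.code]
  symm
  refine Finset.sum_subset (fun j hj => ?_) (fun j _ hj => ?_)
  · simp at hj ⊢; omega
  · refine treeCode_of_lt _ _ _ (lt_of_lt_of_le ?_ (F.le_firstLeaf j))
    simp at hj; omega

theorem IndexedForest.exists_code_eq (n : ℕ) : ∀ c : ℕ → ℕ, (∀ i, n ≤ i → c i = 0) →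
    ∃ F : IndexedForest, F.code = c := by
  induction n with
  | zero =>
    intro c hc
    refine ⟨.empty, funext fun i => ?_⟩
    simp [IndexedForest.code, IndexedForest.empty, treeCode, hc i]
  | succ n ih =>
    intro c hc
    obtain ⟨F, hF⟩ := ih (fun i => c (i + 1)) (fun i hi => hc _ (by omega))
    refine ⟨F.cons (c 0), funext fun i => ?_⟩
    cases i with
    | zero => exact F.code_cons_zero _
    | succ i => rw [F.code_cons_succ, hF]

end EQSymNC

/-! Noncrossing permutations. A generating step at `i` is a move on blocks. If `σ i = i`, the
singleton `i` joins the block of `i + 1`; if `σ (i + 1) = i`, then `i` is split off that block. Both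
moves preserve being noncrossing (`IsCycleRel.merge`, `IsCycleRel.split`). Conversely, a nonidentity
noncrossing permutation always admits a step at a descent (`IsCycleRel.exists_descent`), and such a
step lowers the weighted sum of `sum_mul_swap_lt`, so every element of `NC n` is connected to `1`.
For `f` in `EQSym n` a step does not change the evaluation: when `σ i = i`, the evaluations at `σ`
and `σ * swap i (i + 1)` are one and the same substitution applied to `Rminus i f` and `Rplus i f`
(`ev_mul_swap`).

Existence of the forest polynomials is an integration problem: find `f` with prescribed divided
differences `g i`. The only obstruction is the commutation relation `divDiff_comm`, and it suffices
for finitely supported families (`exists_integral`). Over the coefficient ring `ℤ[t]`, filtered by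
degree in `x`, the inserted scalar affects only lower order terms, so `t` may be set to `0` for the
leading part; there an explicit recursive formula integrates the family up to lower degree, and the
remainder is integrated by induction on the degree. Forests enter only through their codes: terminal
nodes are the descents of the code, trimming is `trimSeq`, and far apart trimmings commute, which
gives the required relation. Subtracting the value at `x = t` and projecting to one degree
normalizes the integral.

Uniqueness: a polynomial with all divided differences zero involves no `x`, hence equals its value
at `x = t`. A padded code of length `n` has no descent except possibly at its last entry, so its
polynomial lies in `EQSym n`; being zero at the identity, it vanishes on all of `NC n`. -/

namespace EQSymNC

/-! ### Noncrossing permutations -/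

/-- The equivalence relation `r` describes a noncrossing partition of `{0, …, n - 1}` (with
singleton blocks outside) whose backwards cycles are the cycles of `σ`. -/
structure IsCycleRel (n : ℕ) (r : Setoid ℕ) (σ : Equiv.Perm ℕ) : Prop where
  bounded : ∀ a b, r a b → a = b ∨ (a < n ∧ b < n)
  noncrossing : ∀ a c b d, a < c → c < b → b < d → r a b → r c d → r a c
  cycle : ∀ a, IsGreatest {b | r a b ∧ b < a} (σ a) ∨
    (IsLeast {b | r a b} a ∧ IsGreatest {b | r a b} (σ a))

theorem IsCycleRel.fixes {n : ℕ} {r : Setoid ℕ} {σ : Equiv.Perm ℕ} (h : IsCycleRel n r σ)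
    (i : ℕ) (hi : n ≤ i) : σ i = i := by
  have : r i (σ i) := by
    rcases h.cycle i with h | h
    · exact h.1.1
    · exact h.2.1
  rcases h.bounded _ _ this with h | h
  · exact h.symm
  · omega

/-- The equivalence relation whose classes are the blocks of a partition of `{0, …, n - 1}` and
singletons. -/
def blockRel {n : ℕ} (P : Finpartition (Finset.range n)) : Setoid ℕ where
  r a b := a = b ∨ ∃ B ∈ P.parts, a ∈ B ∧ b ∈ B
  iseqv := by
    refine ⟨fun a => .inl rfl, ?_, ?_⟩
    · rintro a b (h | ⟨B, hB, h1, h2⟩)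
      · exact .inl h.symm
      · exact .inr ⟨B, hB, h2, h1⟩
    · rintro a b c (rfl | ⟨B, hB, h1, h2⟩) (rfl | ⟨C, hC, h3, h4⟩)
      · exact .inl rfl
      · exact .inr ⟨C, hC, h3, h4⟩
      · exact .inr ⟨B, hB, h1, h2⟩
      · obtain rfl := P.disjoint.elim_finset hB hC b h2 h3
        exact .inr ⟨B, hB, h1, h4⟩

theorem isCycleRel_blockRel {n : ℕ} {P : Finpartition (Finset.range n)} {σ : Equiv.Perm ℕ}
    (hP : IsNoncrossing P) (hfix : ∀ i, n ≤ i → σ i = i)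
    (hσ : ∀ B ∈ P.parts, IsBackwardsCycleOn σ B) : IsCycleRel n (blockRel P) σ := by
  have hlt : ∀ B ∈ P.parts, ∀ a ∈ B, a < n := fun B hB a ha =>
    Finset.mem_range.1 (P.le hB ha)
  refine ⟨?_, ?_, fun a => ?_⟩
  · rintro a b (h | ⟨B, hB, h1, h2⟩)
    · exact .inl h
    · exact .inr ⟨hlt B hB a h1, hlt B hB b h2⟩
  · rintro a c b d hac hcb hbd (h | ⟨B, hB, h1, h2⟩) (h' | ⟨C, hC, h3, h4⟩)
    · omega
    · omega
    · omega
    · by_cases hBC : B = C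
      · subst hBC
        exact .inr ⟨B, hB, h1, h3⟩
      · exact (hP B hB C hC hBC a h1 b h2 c h3 d h4 ⟨hac, hcb, hbd⟩).elim
  · by_cases ha : a < n
    · obtain ⟨B, hB, haB⟩ := P.exists_mem (Finset.mem_range.2 ha)
      have hmem : ∀ b, blockRel P a b ↔ b ∈ B := by
        intro b
        constructor
        · rintro (rfl | ⟨C, hC, h1, h2⟩)
          · exact haB
          · obtain rfl := P.disjoint.elim_finset hB hC a haB h1
            exact h2
        · exact fun h => .inr ⟨B, hB, haB, h⟩
      simp only [hmem]
      exact hσ B hB a haB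
    · have hmem : ∀ b, blockRel P a b ↔ b = a := by
        intro b
        constructor
        · rintro (rfl | ⟨C, hC, h1, h2⟩)
          · rfl
          · exact absurd (hlt C hC a h1) ha
        · rintro rfl
          exact .inl rfl
      right
      simp [hmem, hfix a (by omega)]

open Classical in
/-- The partition of `{0, …, n - 1}` into the classes of an equivalence relation. -/
noncomputable def relPartition (n : ℕ) (r : Setoid ℕ) : Finpartition (Finset.range n) :=
  Finpartition.ofExistsUnique ((Finset.range n).image fun a => (Finset.range n).filter (r a))
    (by
      intro p hp
      obtain ⟨a, -, rfl⟩ := Finset.mem_image.1 hp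
      exact Finset.filter_subset _ _)
    (by
      intro a ha
      refine ⟨(Finset.range n).filter (r a), ⟨Finset.mem_image_of_mem _ ha, ?_⟩, ?_⟩
      · exact Finset.mem_filter.2 ⟨ha, r.refl a⟩
      · rintro B ⟨hB, haB⟩
        obtain ⟨b, -, rfl⟩ := Finset.mem_image.1 hB
        have hba : r b a := (Finset.mem_filter.1 haB).2
        ext c
        simp only [Finset.mem_filter, and_congr_right_iff]
        exact fun _ => ⟨fun h => r.trans (r.symm hba) h, fun h => r.trans hba h⟩)
    (by
      intro h
      obtain ⟨a, ha, h⟩ := Finset.mem_image.1 h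
      exact absurd (h ▸ Finset.mem_filter.2 ⟨ha, r.refl a⟩ : a ∈ (∅ : Finset ℕ)) (by simp))

/-- With equivalence relations on `ℕ` in place of finite partitions, blocks can be merged and split
without rebuilding a `Finpartition`. -/
theorem mem_NC_iff {n : ℕ} {σ : Equiv.Perm ℕ} :
    σ ∈ NC n ↔ ∃ r, IsCycleRel n r σ := by
  classical
  constructor
  · rintro ⟨hfix, P, hP, hσ⟩
    exact ⟨blockRel P, isCycleRel_blockRel hP hfix hσ⟩
  · rintro ⟨r, hr⟩
    have key : ∀ B ∈ (relPartition n r).parts, ∀ a ∈ B, ∀ b, b ∈ B ↔ r a b := by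
      intro B hB a ha b
      obtain ⟨c, -, rfl⟩ := Finset.mem_image.1 hB
      obtain ⟨han, hca⟩ := Finset.mem_filter.1 ha
      simp only [Finset.mem_filter]
      constructor
      · rintro ⟨-, h⟩
        exact r.trans (r.symm hca) h
      · intro h
        refine ⟨?_, r.trans hca h⟩
        rcases hr.bounded _ _ h with rfl | h
        · exact han
        · exact Finset.mem_range.2 h.2
    refine ⟨hr.fixes, relPartition n r, ?_, ?_⟩
    · rintro A hA B hB hAB a ha b hb c hc d hd ⟨hac, hcb, hbd⟩
      have h := hr.noncrossing a c b d hac hcb hbd ((key A hA a ha b).1 hb)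
        ((key B hB c hc d).1 hd)
      exact hAB ((relPartition n r).disjoint.elim_finset hA hB c ((key A hA a ha c).2 h) hc)
    · intro B hB a ha
      have := hr.cycle a
      simp only [← key B hB a ha] at this
      exact this

theorem one_mem_NC (n : ℕ) : (1 : Equiv.Perm ℕ) ∈ NC n := by
  refine mem_NC_iff.2 ⟨⟨Eq, eq_equivalence⟩, fun a b h => .inl h, ?_, fun a => .inr ?_⟩
  · rintro a c b d h1 h2 h3 (rfl : a = b) -
    omega
  · constructor <;> constructor
    · rfl
    · rintro b (rfl : a = b); exact le_rfl
    · rfl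
    · rintro b (rfl : a = b); exact le_rfl

/-- Merging the fixed point `i` into the block of `i + 1`. -/
theorem IsCycleRel.merge {n : ℕ} {r : Setoid ℕ} {σ : Equiv.Perm ℕ} (h : IsCycleRel n r σ)
    {i : ℕ} (hi : i + 1 < n) (hσ : σ i = i) :
    IsCycleRel n (r.comap fun a => if a = i then i + 1 else a) (σ * Equiv.swap i (i + 1)) := by
  have hinj : ∀ a, σ a = i → a = i := fun a ha => σ.injective (ha.trans hσ.symm)
  set φ : ℕ → ℕ := fun a => if a = i then i + 1 else a with hφ
  have hφi : φ i = i + 1 := by simp [hφ]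
  have hφne : ∀ a, a ≠ i → φ a = a := fun a ha => by simp [hφ, ha]
  have hle : ∀ a, a ≤ φ a := fun a => by simp only [hφ]; split_ifs <;> omega
  have hφcases : ∀ a, φ a = a ∨ (a = i ∧ φ a = i + 1) := fun a => by
    by_cases ha : a = i
    · subst ha; exact .inr ⟨rfl, hφi⟩
    · exact .inl (hφne a ha)
  have hrel : ∀ a b, r.comap φ a b ↔ r (φ a) (φ b) := fun a b => Iff.rfl
  refine ⟨?_, ?_, fun a => ?_⟩
  · intro a b hab
    have h1 := h.bounded _ _ ((hrel a b).1 hab)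
    rcases hφcases a with h2 | h2 <;> rcases hφcases b with h3 | h3 <;> omega
  · intro a c b d hac hcb hbd hab hcd
    rw [hrel] at *
    -- `φ` is weakly increasing, so the images of `a < c < b < d` cross for `r` unless two
    -- neighbours coincide; each coincidence gives the claim directly.
    rcases eq_or_ne (φ a) (φ c) with e | e
    · rw [e]
    rcases eq_or_ne (φ c) (φ b) with e' | e'
    · rw [e']; exact hab
    rcases eq_or_ne (φ b) (φ d) with e'' | e''
    · rw [e''] at hab
      exact r.trans hab (r.symm hcd)
    refine h.noncrossing _ _ _ _ ?_ ?_ ?_ hab hcd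
    · rcases hφcases a with h2 | h2 <;> rcases hφcases c with h3 | h3 <;> omega
    · rcases hφcases c with h2 | h2 <;> rcases hφcases b with h3 | h3 <;> omega
    · rcases hφcases b with h2 | h2 <;> rcases hφcases d with h3 | h3 <;> omega
  · simp only [hrel, Equiv.Perm.mul_apply]
    rcases eq_or_ne a (i + 1) with rfl | ha1
    · left
      rw [Equiv.swap_apply_right, hσ]
      refine ⟨⟨?_, by omega⟩, fun b hb => ?_⟩
      · rw [hφi, hφne _ (by omega)]
      · have := hb.2; omega
    rcases eq_or_ne a i with rfl | ha
    · rw [Equiv.swap_apply_left, hφi]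
      have hne : σ (a + 1) ≠ a := fun hh => by have := hinj _ hh; omega
      rcases h.cycle (a + 1) with ⟨⟨h1, h2⟩, h3⟩ | ⟨h1, h2⟩
      · left
        refine ⟨⟨by rwa [hφne _ hne], by omega⟩, ?_⟩
        rintro b ⟨hb, hb'⟩
        rw [hφne _ (by omega)] at hb
        exact h3 ⟨hb, by omega⟩
      · right
        refine ⟨⟨by rw [Set.mem_ofPred_eq, hφi], fun b hb => ?_⟩,
          ⟨?_, fun b hb => ?_⟩⟩
        · have := h1.2 hb
          rcases hφcases b with h3 | h3 <;> omega
        · rw [Set.mem_ofPred_eq, hφne _ hne]; exact h2.1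
        · exact (hle b).trans (h2.2 hb)
    · rw [Equiv.swap_apply_of_ne_of_ne ha ha1, hφne a ha]
      have hne : σ a ≠ i := fun hh => ha (hinj _ hh)
      rcases h.cycle a with ⟨⟨h1, h2⟩, h3⟩ | ⟨h1, h2⟩
      · left
        refine ⟨⟨by rwa [hφne _ hne], h2⟩, ?_⟩
        rintro b ⟨hb, hb'⟩
        refine (hle b).trans (h3 ⟨hb, ?_⟩)
        rcases hφcases b with h4 | h4 <;> omega
      · right
        refine ⟨⟨by rw [Set.mem_ofPred_eq, hφne a ha], fun b hb => ?_⟩, ⟨?_, fun b hb => ?_⟩⟩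
        · have := h1.2 hb
          rcases hφcases b with h3 | h3 <;> omega
        · rw [Set.mem_ofPred_eq, hφne _ hne]; exact h2.1
        · exact (hle b).trans (h2.2 hb)

/-- The equivalence relation obtained by making `i` a singleton class. -/
def isolate (r : Setoid ℕ) (i : ℕ) : Setoid ℕ where
  r a b := a = b ∨ (a ≠ i ∧ b ≠ i ∧ r a b)
  iseqv := by
    refine ⟨fun a => .inl rfl, ?_, ?_⟩
    · rintro a b (h | ⟨h1, h2, h3⟩)
      · exact .inl h.symm
      · exact .inr ⟨h2, h1, r.symm h3⟩
    · rintro a b c (rfl | ⟨h1, h2, h3⟩) (rfl | ⟨h4, h5, h6⟩)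
      · exact .inl rfl
      · exact .inr ⟨h4, h5, h6⟩
      · exact .inr ⟨h1, h2, h3⟩
      · exact .inr ⟨h1, h5, r.trans h3 h6⟩

/-- Splitting `i` off the block of `i + 1`. -/
theorem IsCycleRel.split {n : ℕ} {r : Setoid ℕ} {σ : Equiv.Perm ℕ} (h : IsCycleRel n r σ)
    {i : ℕ} (hσ : σ (i + 1) = i) :
    IsCycleRel n (isolate r i) (σ * Equiv.swap i (i + 1)) := by
  have hinj : ∀ a, σ a = i → a = i + 1 := fun a ha => σ.injective (ha.trans hσ.symm)
  have hrel : ∀ a b, isolate r i a b ↔ a = b ∨ (a ≠ i ∧ b ≠ i ∧ r a b) := fun a b => Iff.rfl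
  have hsub : ∀ a b, isolate r i a b → r a b := by
    rintro a b (rfl | h)
    · exact r.refl _
    · exact h.2.2
  have hi : r (i + 1) i := by
    rcases h.cycle (i + 1) with h | h
    · have := h.1.1
      rwa [hσ] at this
    · have := h.2.1
      rwa [hσ] at this
  refine ⟨fun a b hab => h.bounded a b (hsub a b hab), ?_, fun a => ?_⟩
  · rintro a c b d hac hcb hbd (rfl | ⟨h1, h2, h3⟩) (rfl | ⟨h4, h5, h6⟩)
    · omega
    · omega
    · omega
    · exact .inr ⟨h1, h4, h.noncrossing a c b d hac hcb hbd h3 h6⟩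
  · simp only [Equiv.Perm.mul_apply]
    rcases eq_or_ne a i with rfl | ha
    · right
      have hcls : ∀ b, isolate r a a b ↔ b = a := fun b => by
        rw [hrel]; constructor
        · rintro (h | h)
          · exact h.symm
          · exact absurd rfl h.1
        · exact fun h => .inl h.symm
      simp [hcls, hσ]
    have hcls : ∀ b, isolate r i a b ↔ b ≠ i ∧ r a b := fun b => by
      rw [hrel]; constructor
      · rintro (rfl | h)
        · exact ⟨ha, r.refl _⟩
        · exact h.2
      · exact fun h => .inr ⟨ha, h⟩
    simp only [hcls]
    rcases eq_or_ne a (i + 1) with rfl | ha1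
    · rw [Equiv.swap_apply_right]
      have hne : σ i ≠ i := fun hh => by have := hinj _ hh; omega
      rcases h.cycle i with ⟨⟨h1, h2⟩, h3⟩ | ⟨h1, h2⟩
      · left
        refine ⟨⟨⟨hne, r.trans hi h1⟩, by omega⟩, ?_⟩
        rintro b ⟨⟨hb, hb'⟩, hb''⟩
        exact h3 ⟨r.trans (r.symm hi) hb', by omega⟩
      · right
        refine ⟨⟨⟨ha, r.refl _⟩, ?_⟩, ⟨⟨hne, r.trans hi h2.1⟩, ?_⟩⟩
        · rintro b ⟨hb, hb'⟩
          have := h1.2 (r.trans (r.symm hi) hb')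
          omega
        · rintro b ⟨hb, hb'⟩
          exact h2.2 (r.trans (r.symm hi) hb')
    · rw [Equiv.swap_apply_of_ne_of_ne ha ha1]
      have hne : σ a ≠ i := fun hh => ha1 (hinj _ hh)
      rcases h.cycle a with ⟨⟨h1, h2⟩, h3⟩ | ⟨h1, h2⟩
      · left
        exact ⟨⟨⟨hne, h1⟩, h2⟩, fun b hb => h3 ⟨hb.1.2, hb.2⟩⟩
      · right
        exact ⟨⟨⟨ha, r.refl _⟩, fun b hb => h1.2 hb.2⟩, ⟨⟨hne, h2.1⟩, fun b hb => h2.2 hb.2⟩⟩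

/-! ### Connectedness of the noncrossing permutations -/

theorem NCStep.symm {n : ℕ} {σ τ : Equiv.Perm ℕ} (h : NCStep n σ τ) : NCStep n τ σ := by
  obtain ⟨i, hi, hσ, rfl⟩ := h
  refine ⟨i, hi, ?_, ?_⟩
  · simpa [or_comm] using hσ
  · rw [mul_assoc, Equiv.swap_mul_self, mul_one]

theorem NCStep.mem_NC {n : ℕ} {σ τ : Equiv.Perm ℕ} (h : NCStep n σ τ) (hσ : σ ∈ NC n) :
    τ ∈ NC n := by
  obtain ⟨r, hr⟩ := mem_NC_iff.1 hσ
  obtain ⟨i, hi, h | h, rfl⟩ := h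
  · exact mem_NC_iff.2 ⟨_, hr.merge hi h⟩
  · exact mem_NC_iff.2 ⟨_, hr.split h⟩

theorem eqvGen_mem_NC_iff {n : ℕ} {σ τ : Equiv.Perm ℕ} (h : Relation.EqvGen (NCStep n) σ τ) :
    σ ∈ NC n ↔ τ ∈ NC n := by
  induction h with
  | rel σ τ h => exact ⟨h.mem_NC, h.symm.mem_NC⟩
  | refl => rfl
  | symm _ _ _ ih => exact ih.symm
  | trans _ _ _ _ _ ih1 ih2 => exact ih1.trans ih2

/-- Let `b` be the smallest element with `σ b < b`. If `σ b = b - 1`, take `i = b - 1`: by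
minimality of `b` it is the least element of its block, so `σ i` is the largest and is at least `b`.
Otherwise take `i = b - 1` as well, which lies strictly between `σ b` and `b`. It is the least of
its block, and a further element of that block would cross the pair `σ b, b` or be `b` itself, so
`i` is fixed. -/
theorem IsCycleRel.exists_descent {n : ℕ} {r : Setoid ℕ} {σ : Equiv.Perm ℕ}
    (h : IsCycleRel n r σ) (hσ : σ ≠ 1) :
    ∃ i, i + 1 < n ∧ (σ i = i ∨ σ (i + 1) = i) ∧ σ (i + 1) < σ i := by
  classical
  have hge : ∀ j, ¬ σ j < j → IsLeast {b | r j b} j ∧ IsGreatest {b | r j b} (σ j) := by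
    intro j hj
    rcases h.cycle j with h | h
    · exact absurd h.1.2 hj
    · exact h
  have hex : ∃ b, σ b < b := by
    by_contra! hcon
    refine hσ (Equiv.ext fun j => ?_)
    have h1 := hge j (not_lt.2 (hcon j))
    have h2 := hge (σ j) (not_lt.2 (hcon _))
    exact le_antisymm (h2.1.2 (r.symm h1.2.1)) (hcon j)
  obtain ⟨b, hb, hmin⟩ : ∃ b, σ b < b ∧ ∀ j < b, ¬ σ j < j :=
    ⟨Nat.find hex, Nat.find_spec hex, fun j hj => Nat.find_min hex hj⟩
  have hbn : b < n := by
    by_contra hcon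
    have := h.fixes b (by omega)
    omega
  have hba : r b (σ b) := by
    rcases h.cycle b with h | h
    · exact h.1.1
    · exact h.2.1
  rcases Nat.lt_or_ge (σ b + 1) b with hlt | hle
  · obtain ⟨j, rfl⟩ : ∃ j, b = j + 1 := ⟨b - 1, by omega⟩
    obtain ⟨h1, h2⟩ := hge j (hmin j (by omega))
    have hnot : ¬ r j (σ (j + 1)) := fun hh => by
      have := h1.2 hh; omega
    have hfix : σ j = j := by
      by_contra hne
      have h3 : j ≤ σ j := not_lt.1 (hmin j (by omega))
      rcases Nat.lt_or_ge (j + 1) (σ j) with h4 | h4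
      · exact hnot (r.symm (h.noncrossing _ j (j + 1) (σ j) (by omega) (by omega) h4
          (r.symm hba) h2.1))
      · have h5 : σ j = j + 1 := by omega
        exact hnot (r.trans (h5 ▸ h2.1 : r j (j + 1)) hba)
    exact ⟨j, hbn, .inl hfix, by omega⟩
  · have hb' : b = σ b + 1 := by omega
    obtain ⟨h1, h2⟩ := hge (σ b) (hmin _ hb)
    have := h2.2 (r.symm hba)
    exact ⟨σ b, by omega, .inr (by rw [← hb']), by rw [← hb']; omega⟩

/-- The weights `n - k` drop by one from `i` to `i + 1`, so undoing a descent lowers the sum by `σ i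
- σ (i + 1)`. This is the measure for the descent to the identity. -/
theorem sum_mul_swap_lt {n i : ℕ} (hi : i + 1 < n) {σ : Equiv.Perm ℕ} (h : σ (i + 1) < σ i) :
    ∑ k ∈ Finset.range n, (n - k) * (σ * Equiv.swap i (i + 1)) k <
      ∑ k ∈ Finset.range n, (n - k) * σ k := by
  have h1 : i ∈ Finset.range n := by simp; omega
  have h2 : i + 1 ∈ (Finset.range n).erase i := by simp; omega
  rw [← Finset.add_sum_erase _ _ h1, ← Finset.add_sum_erase _ _ h2,
    ← Finset.add_sum_erase _ (fun k => (n - k) * σ k) h1,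
    ← Finset.add_sum_erase _ (fun k => (n - k) * σ k) h2]
  have h3 : ∑ k ∈ ((Finset.range n).erase i).erase (i + 1),
      (n - k) * (σ * Equiv.swap i (i + 1)) k =
      ∑ k ∈ ((Finset.range n).erase i).erase (i + 1), (n - k) * σ k := by
    refine Finset.sum_congr rfl fun k hk => ?_
    simp only [Finset.mem_erase] at hk
    rw [Equiv.Perm.mul_apply, Equiv.swap_apply_of_ne_of_ne hk.2.1 hk.1]
  rw [h3]
  simp only [Equiv.Perm.mul_apply, Equiv.swap_apply_left, Equiv.swap_apply_right]
  obtain ⟨m, rfl⟩ : ∃ m, n = i + 1 + m := ⟨n - (i + 1), by omega⟩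
  rw [show i + 1 + m - i = m + 1 by omega, show i + 1 + m - (i + 1) = m by omega]
  nlinarith

theorem eqvGen_of_mem_NC {n : ℕ} {σ : Equiv.Perm ℕ} (hσ : σ ∈ NC n) :
    Relation.EqvGen (NCStep n) 1 σ := by
  induction hm : ∑ k ∈ Finset.range n, (n - k) * σ k using Nat.strong_induction_on
    generalizing σ with
  | _ m ih =>
    by_cases h1 : σ = 1
    · subst h1; exact .refl _
    · obtain ⟨r, hr⟩ := mem_NC_iff.1 hσ
      obtain ⟨i, hi, hσi, hlt⟩ := hr.exists_descent h1
      have hstep : NCStep n σ (σ * Equiv.swap i (i + 1)) := ⟨i, hi, hσi, rfl⟩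
      exact .trans _ _ _ (ih _ (hm ▸ sum_mul_swap_lt hi hlt) (hstep.mem_NC hσ) rfl)
        (.rel _ _ hstep.symm)

theorem NC_eq_eqvGen (n : ℕ) : NC n = {σ | Relation.EqvGen (NCStep n) 1 σ} :=
  Set.ext fun _ => ⟨eqvGen_of_mem_NC, fun h => (eqvGen_mem_NC_iff h).1 (one_mem_NC n)⟩

/-! ### Evaluations of equivariantly quasisymmetric polynomials -/

theorem ev_mul_swap {i : ℕ} {f : Poly} (hf : Rplus i f = Rminus i f) {σ : Equiv.Perm ℕ}
    (hσ : σ i = i) : ev (σ * Equiv.swap i (i + 1)) f = ev σ f := by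
  -- `θ` evaluates at the word of `σ` with the letter in position `i` removed; since `σ i = i`,
  -- inserting `t i` at `i` or at `i + 1` restores the two words.
  let θ : Poly →ₐ[ℤ] MvPolynomial ℕ ℤ := MvPolynomial.aeval
    (Sum.elim (fun j => MvPolynomial.X (if j < i then σ j else σ (j + 1))) MvPolynomial.X)
  have h1 : ev σ = θ.comp (Rminus i) := by
    refine MvPolynomial.algHom_ext fun k => ?_
    rcases k with j | j
    · simp only [ev, Rminus, θ, AlgHom.comp_apply, MvPolynomial.aeval_X, Sum.elim_inl]
      split_ifs with h h'
      · simp [x, h]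
      · subst h'; simp [t, hσ]
      · simp [x, show ¬ j - 1 < i by omega, show j - 1 + 1 = j by omega]
    · simp [ev, Rminus, θ, t]
  have h2 : ev (σ * Equiv.swap i (i + 1)) = θ.comp (Rplus i) := by
    refine MvPolynomial.algHom_ext fun k => ?_
    rcases k with j | j
    · simp only [ev, Rplus, θ, AlgHom.comp_apply, MvPolynomial.aeval_X, Sum.elim_inl]
      split_ifs with h h'
      · rcases Nat.lt_or_ge j i with h' | h'
        · simp [x, h', Equiv.swap_apply_of_ne_of_ne h'.ne (show j ≠ i + 1 by omega)]
        · obtain rfl : j = i := by omega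
          simp [x]
      · subst h'; simp [t, hσ]
      · simp [x, show ¬ j - 1 < i by omega, show j - 1 + 1 = j by omega,
          Equiv.swap_apply_of_ne_of_ne (show j ≠ i by omega) h']
    · simp [ev, Rplus, θ, t]
  rw [h1, h2, AlgHom.comp_apply, AlgHom.comp_apply, hf]

theorem NCStep.ev_eq {n : ℕ} {f : Poly} (hf : f ∈ EQSym n) {σ τ : Equiv.Perm ℕ}
    (h : NCStep n σ τ) : ev τ f = ev σ f := by
  obtain ⟨i, hi, h | h, rfl⟩ := h
  · exact ev_mul_swap (hf.2 i hi) h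
  -- Here it is `σ * swap i (i + 1)` that fixes `i`.
  · have := ev_mul_swap (hf.2 i hi) (σ := σ * Equiv.swap i (i + 1)) (by simpa using h)
    rw [mul_assoc, Equiv.swap_mul_self, mul_one] at this
    exact this.symm

theorem ev_eq_of_eqvGen {n : ℕ} {f : Poly} (hf : f ∈ EQSym n) {σ τ : Equiv.Perm ℕ}
    (h : Relation.EqvGen (NCStep n) σ τ) : ev τ f = ev σ f := by
  induction h with
  | rel _ _ h => exact h.ev_eq hf
  | refl => rfl
  | symm _ _ _ ih => exact ih.symm
  | trans _ _ _ _ _ ih1 ih2 => exact ih2.trans ih1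

theorem ev_eq_of_mem_NC {n : ℕ} {f : Poly} (hf : f ∈ EQSym n) {σ : Equiv.Perm ℕ}
    (hσ : σ ∈ NC n) : ev σ f = ev 1 f :=
  ev_eq_of_eqvGen hf (eqvGen_of_mem_NC hσ)

/-! ### Divided differences over a coefficient ring -/

section Integration

open MvPolynomial

variable {A : Type*} [CommRing A]

/-- Put the scalar `p` in position `i` and move the later variables one position to the right. -/
noncomputable def insertAt (i : ℕ) (p : A) : MvPolynomial ℕ A →ₐ[A] MvPolynomial ℕ A :=
  aeval fun k => if k < i then X k else if k = i then C p else X (k - 1)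

theorem insertAt_X_of_lt {i k : ℕ} (h : k < i) (p : A) : insertAt i p (X k) = X k := by
  simp [insertAt, h]

theorem insertAt_X_self (i : ℕ) (p : A) : insertAt i p (X i) = C p := by
  simp [insertAt]

theorem insertAt_X_of_gt {i k : ℕ} (h : i < k) (p : A) : insertAt i p (X k) = X (k - 1) := by
  simp [insertAt, h.not_gt, h.ne']

theorem insertAt_C (i : ℕ) (p a : A) : insertAt i p (C a) = C a := by
  simp [insertAt]

theorem insertAt_comm {a b : ℕ} (h : a < b) (p q : A) (f : MvPolynomial ℕ A) :
    insertAt a p (insertAt b q f) = insertAt (b - 1) q (insertAt a p f) := by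
  suffices (insertAt a p).comp (insertAt b q) = (insertAt (b - 1) q).comp (insertAt a p) from
    DFunLike.congr_fun this f
  refine algHom_ext fun k => ?_
  simp only [AlgHom.comp_apply]
  rcases lt_trichotomy k b with hk | rfl | hk
  · rw [insertAt_X_of_lt hk]
    rcases lt_trichotomy k a with hk' | rfl | hk'
    · rw [insertAt_X_of_lt hk', insertAt_X_of_lt (by omega)]
    · rw [insertAt_X_self, insertAt_C]
    · rw [insertAt_X_of_gt hk', insertAt_X_of_lt (by omega)]
  · rw [insertAt_X_self, insertAt_C, insertAt_X_of_gt h, insertAt_X_self]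
  · rw [insertAt_X_of_gt hk, insertAt_X_of_gt (by omega), insertAt_X_of_gt (by omega),
      insertAt_X_of_gt (by omega)]

/-- The two insertions are ring homomorphisms that agree on every variable modulo `X i - C p`: only
`X i` and `X (i + 1)` have different images, which differ by `±(X i - C p)`. -/
theorem sub_dvd_insertAt_sub (i : ℕ) (p : A) (f : MvPolynomial ℕ A) :
    X i - C p ∣ insertAt (i + 1) p f - insertAt i p f := by
  induction f using MvPolynomial.induction_on with
  | C a => simp
  | add f g hf hg =>
    rw [map_add, map_add, add_sub_add_comm]
    exact dvd_add hf hg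
  | mul_X f k hf =>
    rw [map_mul, map_mul, show ∀ a b c d : MvPolynomial ℕ A,
      a * b - c * d = (a - c) * b + c * (b - d) by intros; ring]
    refine dvd_add (hf.mul_right _) (Dvd.dvd.mul_left ?_ _)
    rcases lt_trichotomy k i with hk | rfl | hk
    · rw [insertAt_X_of_lt hk, insertAt_X_of_lt (by omega), sub_self]
      exact dvd_zero _
    · rw [insertAt_X_self, insertAt_X_of_lt (by omega)]
    · rw [insertAt_X_of_gt hk]
      rcases eq_or_lt_of_le (Nat.succ_le_of_lt hk) with rfl | hk'
      · rw [insertAt_X_self, ← neg_dvd, neg_sub]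
        exact dvd_refl _
      · rw [insertAt_X_of_gt hk', sub_self]
        exact dvd_zero _

/-- The divided difference `(f(…, x_i, p, …) - f(…, p, x_i, …)) / (x_i - p)`. -/
noncomputable def divDiff (i : ℕ) (p : A) (f : MvPolynomial ℕ A) : MvPolynomial ℕ A :=
  (sub_dvd_insertAt_sub i p f).choose

theorem sub_mul_divDiff (i : ℕ) (p : A) (f : MvPolynomial ℕ A) :
    (X i - C p) * divDiff i p f = insertAt (i + 1) p f - insertAt i p f :=
  (sub_dvd_insertAt_sub i p f).choose_spec.symm

theorem X_sub_C_ne_zero [Nontrivial A] (i : ℕ) (p : A) : (X i - C p : MvPolynomial ℕ A) ≠ 0 := by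
  intro h
  have := congrArg (eval fun _ => p + 1) h
  simp at this

/-! ### The filtration by degree -/

variable (A) in
/-- The polynomials of degree less than `d`. -/
noncomputable def degreeLT : ℕ → Submodule A (MvPolynomial ℕ A)
  | 0 => ⊥
  | d + 1 => restrictTotalDegree ℕ A d

theorem mem_degreeLT_succ {d : ℕ} {f : MvPolynomial ℕ A} :
    f ∈ degreeLT A (d + 1) ↔ f.totalDegree ≤ d := mem_restrictTotalDegree _ _ _

theorem mem_degreeLT_zero {f : MvPolynomial ℕ A} : f ∈ degreeLT A 0 ↔ f = 0 :=
  Submodule.mem_bot _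

theorem mul_mem_degreeLT {d e : ℕ} {f g : MvPolynomial ℕ A} (hf : f ∈ degreeLT A d)
    (hg : g.totalDegree ≤ e) : f * g ∈ degreeLT A (d + e) := by
  cases d with
  | zero => rw [mem_degreeLT_zero.1 hf, zero_mul]; exact zero_mem _
  | succ d =>
    rw [add_right_comm]
    rw [mem_degreeLT_succ] at *
    exact (totalDegree_mul _ _).trans (by omega)

theorem X_mul_mem_degreeLT [Nontrivial A] {d : ℕ} (i : ℕ) {f : MvPolynomial ℕ A} (hf : f ∈ degreeLT A d) :
    X i * f ∈ degreeLT A (d + 1) := by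
  rw [mul_comm]
  exact mul_mem_degreeLT hf (totalDegree_X _).le

theorem totalDegree_X_sub_C [Nontrivial A] (i : ℕ) (p : A) :
    (X i - C p : MvPolynomial ℕ A).totalDegree = 1 := by
  rw [sub_eq_add_neg, ← C_neg, totalDegree_add_eq_left_of_totalDegree_lt]
  · exact totalDegree_X _
  · simp

theorem totalDegree_insertAt_X_le [Nontrivial A] (i : ℕ) (p : A) (k : ℕ) :
    (insertAt i p (X k)).totalDegree ≤ 1 := by
  rcases lt_trichotomy k i with hk | rfl | hk
  · rw [insertAt_X_of_lt hk, totalDegree_X]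
  · rw [insertAt_X_self]; simp
  · rw [insertAt_X_of_gt hk, totalDegree_X]

theorem insertAt_X_sub (i : ℕ) (p q : A) (k : ℕ) :
    ∃ c : A, insertAt i p (X k) - insertAt i q (X k) = C c := by
  rcases lt_trichotomy k i with hk | rfl | hk
  · exact ⟨0, by simp [insertAt_X_of_lt hk]⟩
  · exact ⟨p - q, by simp [insertAt_X_self]⟩
  · exact ⟨0, by simp [insertAt_X_of_gt hk]⟩

theorem mem_degreeLT_induction {P : MvPolynomial ℕ A → Prop} {d : ℕ} {f : MvPolynomial ℕ A}
    (hf : f ∈ degreeLT A d) (h0 : P 0) (hadd : ∀ f g, P f → P g → P (f + g))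
    (hmon : ∀ s a, monomial s a ∈ degreeLT A d → P (monomial s a)) : P f := by
  rw [f.as_sum]
  refine Finset.sum_induction _ P hadd h0 fun s hs => hmon s _ ?_
  cases d with
  | zero => rw [mem_degreeLT_zero.1 hf] at hs; simp at hs
  | succ d =>
    rw [mem_degreeLT_succ] at *
    exact (totalDegree_monomial_le _ _).trans ((le_totalDegree hs).trans hf)

/-! ### Properties of divided differences -/

theorem insertAt_eq_self {f : MvPolynomial ℕ A} {n : ℕ} (hf : ∀ j ∈ f.vars, j < n) {i : ℕ}
    (hi : n ≤ i) (p : A) : insertAt i p f = f := by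
  conv_rhs => rw [← aeval_X_left_apply f]
  refine eval₂Hom_congr' rfl (fun j hj _ => ?_) rfl
  rw [if_pos ((hf j hj).trans_le hi)]

theorem exists_vars_lt (f : MvPolynomial ℕ A) : ∃ n, ∀ j ∈ f.vars, j < n :=
  ⟨f.vars.sup id + 1, fun _ hj => Nat.lt_succ_of_le (Finset.le_sup (f := id) hj)⟩

/-- Telescoping: at `p = 0` each summand is the increment of `insertAt k 0 f` in `k`. -/
theorem sum_X_mul_divDiff (f : MvPolynomial ℕ A) {i j : ℕ} (h : i ≤ j) :
    ∑ k ∈ Finset.Ico i j, X k * divDiff k 0 f = insertAt j 0 f - insertAt i 0 f := by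
  rw [← Finset.sum_Ico_sub (fun k => insertAt k 0 f) h]
  refine Finset.sum_congr rfl fun k _ => ?_
  rw [← sub_mul_divDiff, C_0, sub_zero]

variable [IsDomain A]

theorem divDiff_eq_iff {i : ℕ} {p : A} {f g : MvPolynomial ℕ A} :
    divDiff i p f = g ↔ (X i - C p) * g = insertAt (i + 1) p f - insertAt i p f := by
  rw [← sub_mul_divDiff]
  exact ⟨fun h => h ▸ rfl, fun h => (mul_left_cancel₀ (X_sub_C_ne_zero i p) h).symm⟩

theorem divDiff_add (i : ℕ) (p : A) (f g : MvPolynomial ℕ A) :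
    divDiff i p (f + g) = divDiff i p f + divDiff i p g := by
  rw [divDiff_eq_iff, mul_add, sub_mul_divDiff, sub_mul_divDiff, map_add, map_add]
  ring

theorem divDiff_sub (i : ℕ) (p : A) (f g : MvPolynomial ℕ A) :
    divDiff i p (f - g) = divDiff i p f - divDiff i p g := by
  rw [divDiff_eq_iff, mul_sub, sub_mul_divDiff, sub_mul_divDiff, map_sub, map_sub]
  ring

theorem divDiff_zero (i : ℕ) (p : A) : divDiff i p 0 = 0 := by
  rw [divDiff_eq_iff]; simp

theorem divDiff_insertAt {a i : ℕ} (h : a ≤ i) (p q : A) (f : MvPolynomial ℕ A) :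
    divDiff i q (insertAt a p f) = insertAt a p (divDiff (i + 1) q f) := by
  have e : (X i - C q : MvPolynomial ℕ A) = insertAt a p (X (i + 1) - C q) := by
    rw [map_sub, insertAt_C, insertAt_X_of_gt (by omega), Nat.add_sub_cancel]
  rw [divDiff_eq_iff, e, ← map_mul, sub_mul_divDiff, map_sub,
    insertAt_comm (show a < i + 1 + 1 by omega), insertAt_comm (show a < i + 1 by omega)]
  rfl

theorem insertAt_divDiff {a i : ℕ} (h : i + 1 < a) (p q : A) (f : MvPolynomial ℕ A) :
    divDiff i q (insertAt a p f) = insertAt (a - 1) p (divDiff i q f) := by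
  have e : (X i - C q : MvPolynomial ℕ A) = insertAt (a - 1) p (X i - C q) := by
    rw [map_sub, insertAt_C, insertAt_X_of_lt (by omega)]
  rw [divDiff_eq_iff, e, ← map_mul, sub_mul_divDiff, map_sub,
    ← insertAt_comm (show i + 1 < a by omega), ← insertAt_comm (show i < a by omega)]

/-- The slots `i, i + 1` and `j, j + 1` are disjoint, so the insertions commute up to the shift of
`j` to `j - 1`. This is the integrability condition, and it passes to the remainder after a partial
integration. -/
theorem divDiff_comm {i j : ℕ} (h : i + 1 < j) (p q : A) (f : MvPolynomial ℕ A) :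
    divDiff i p (divDiff j q f) = divDiff (j - 1) q (divDiff i p f) := by
  symm
  obtain ⟨j, rfl⟩ : ∃ k, j = k + 1 := ⟨j - 1, by omega⟩
  rw [Nat.add_sub_cancel, divDiff_eq_iff]
  have h1 := insertAt_divDiff (i := i) (a := j + 1) h q p f
  have h2 := insertAt_divDiff (i := i) (a := j + 1 + 1) (by omega) q p f
  rw [Nat.add_sub_cancel] at h1 h2
  rw [← h1, ← h2, ← divDiff_sub, ← sub_mul_divDiff (j + 1)]
  symm
  rw [divDiff_eq_iff, map_mul, map_mul, map_sub, map_sub, insertAt_C, insertAt_C,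
    insertAt_X_of_gt (by omega), insertAt_X_of_gt (by omega), Nat.add_sub_cancel,
    mul_left_comm, sub_mul_divDiff]
  ring

theorem mem_degreeLT_of_mul {d : ℕ} {i : ℕ} {p : A} {f : MvPolynomial ℕ A}
    (hf : (X i - C p) * f ∈ degreeLT A (d + 1)) : f ∈ degreeLT A d := by
  by_cases h0 : f = 0
  · rw [h0]; exact zero_mem _
  rw [mem_degreeLT_succ, totalDegree_mul_of_isDomain (X_sub_C_ne_zero i p) h0,
    totalDegree_X_sub_C] at hf
  obtain ⟨e, rfl⟩ : ∃ k, d = k + 1 := ⟨d - 1, by omega⟩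
  rw [mem_degreeLT_succ]
  omega

/-- Scalars of `A` have degree `0`, and changing the inserted scalar moves the image of each
variable by a constant only. The two claims go together because the product step for the difference
uses the degree bound for the insertion. -/
theorem insertAt_mem_and_sub_mem {d i : ℕ} (p q : A) {f : MvPolynomial ℕ A}
    (hf : f ∈ degreeLT A d) :
    insertAt i p f ∈ degreeLT A d ∧ insertAt i p f - insertAt i q f ∈ degreeLT A (d - 1) := by
  refine mem_degreeLT_induction (P := fun f => insertAt i p f ∈ degreeLT A d ∧
    insertAt i p f - insertAt i q f ∈ degreeLT A (d - 1)) hf ?_ ?_ ?_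
  · simp
  · rintro f g ⟨h1, h2⟩ ⟨h3, h4⟩
    rw [map_add, map_add, add_sub_add_comm]
    exact ⟨add_mem h1 h3, add_mem h2 h4⟩
  · intro s a
    clear hf f
    revert d
    refine induction_on_monomial (motive := fun f => ∀ {d}, f ∈ degreeLT A d →
      insertAt i p f ∈ degreeLT A d ∧ insertAt i p f - insertAt i q f ∈ degreeLT A (d - 1))
      ?_ ?_ s a
    · intro a d ha
      rw [insertAt_C, insertAt_C, sub_self]
      exact ⟨ha, zero_mem _⟩
    · intro f k ih d hf
      by_cases h0 : f = 0
      · simp [h0]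
      cases d with
      | zero =>
        have := mem_degreeLT_zero.1 hf
        simp [h0] at this
      | succ d =>
        have hfd : f ∈ degreeLT A d := by
          have : (X k - C 0) * f ∈ degreeLT A (d + 1) := by rwa [C_0, sub_zero, mul_comm]
          exact mem_degreeLT_of_mul this
        obtain ⟨h1, h2⟩ := ih hfd
        rw [map_mul, map_mul, show ∀ a b c d : MvPolynomial ℕ A,
          a * b - c * d = (a - c) * d + a * (b - d) by intros; ring]
        refine ⟨mul_mem_degreeLT h1 (totalDegree_insertAt_X_le _ _ _), add_mem ?_ ?_⟩
        · cases d with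
          | zero => exact (h0 (mem_degreeLT_zero.1 hfd)).elim
          | succ d => exact mul_mem_degreeLT h2 (totalDegree_insertAt_X_le _ _ _)
        · obtain ⟨c, hc⟩ := insertAt_X_sub i p q k
          rw [hc]
          exact mul_mem_degreeLT (e := 0) h1 (totalDegree_C c).le

theorem insertAt_mem_degreeLT {d i : ℕ} (p : A) {f : MvPolynomial ℕ A}
    (hf : f ∈ degreeLT A d) : insertAt i p f ∈ degreeLT A d :=
  (insertAt_mem_and_sub_mem p p hf).1

theorem insertAt_sub_mem_degreeLT {d i : ℕ} (p q : A) {f : MvPolynomial ℕ A}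
    (hf : f ∈ degreeLT A (d + 1)) : insertAt i p f - insertAt i q f ∈ degreeLT A d :=
  (insertAt_mem_and_sub_mem p q hf).2

theorem divDiff_mem_degreeLT {d i : ℕ} (p : A) {f : MvPolynomial ℕ A}
    (hf : f ∈ degreeLT A (d + 1)) : divDiff i p f ∈ degreeLT A d := by
  refine mem_degreeLT_of_mul (i := i) (p := p) ?_
  rw [sub_mul_divDiff]
  exact sub_mem (insertAt_mem_degreeLT p hf) (insertAt_mem_degreeLT p hf)

/-- The leading part of a divided difference does not depend on the inserted scalar, so integration
may be done at `0` first. -/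
theorem divDiff_sub_mem_degreeLT {d i : ℕ} (p q : A) {f : MvPolynomial ℕ A}
    (hf : f ∈ degreeLT A (d + 2)) : divDiff i p f - divDiff i q f ∈ degreeLT A d := by
  refine mem_degreeLT_of_mul (i := i) (p := p) ?_
  have e : (X i - C p) * (divDiff i p f - divDiff i q f) =
      (insertAt (i + 1) p f - insertAt (i + 1) q f) - (insertAt i p f - insertAt i q f) +
        divDiff i q f * C (p - q) := by
    have h1 := sub_mul_divDiff i p f
    have h2 := sub_mul_divDiff i q f
    rw [C_sub]
    linear_combination h1 - h2
  rw [e]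
  exact add_mem (sub_mem (insertAt_sub_mem_degreeLT p q hf) (insertAt_sub_mem_degreeLT p q hf))
    (mul_mem_degreeLT (e := 0) (divDiff_mem_degreeLT q hf) (totalDegree_C _).le)

theorem divDiff_sub_mem_degreeLT' {d i : ℕ} (p q : A) {f : MvPolynomial ℕ A}
    (hf : f ∈ degreeLT A (d + 1)) : divDiff i p f - divDiff i q f ∈ degreeLT A (d - 1) := by
  cases d with
  | zero =>
    exact sub_mem (divDiff_mem_degreeLT p hf) (divDiff_mem_degreeLT q hf)
  | succ d => exact divDiff_sub_mem_degreeLT p q hf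

/-! ### Integration -/

theorem divDiff_X_mul (i j : ℕ) (g : MvPolynomial ℕ A) :
    divDiff j 0 (X i * g) =
      if i < j then X i * divDiff j 0 g
      else if i = j then insertAt (j + 1) 0 g
      else if i = j + 1 then - insertAt j 0 g
      else X (i - 1) * divDiff j 0 g := by
  have h0 := sub_mul_divDiff j 0 g
  rw [divDiff_eq_iff, map_mul, map_mul]
  rw [C_0, sub_zero] at *
  split_ifs with h1 h2 h3
  · rw [insertAt_X_of_lt h1, insertAt_X_of_lt (by omega), mul_left_comm, h0]; ring
  · subst h2
    rw [insertAt_X_self, insertAt_X_of_lt (by omega), C_0, zero_mul, sub_zero]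
  · subst h3
    rw [insertAt_X_self, insertAt_X_of_gt (by omega), C_0, Nat.add_sub_cancel]; ring
  · rw [insertAt_X_of_gt (by omega), insertAt_X_of_gt (by omega), mul_left_comm, h0]; ring

theorem divDiff_sum (i : ℕ) (p : A) (s : Finset ℕ) (g : ℕ → MvPolynomial ℕ A) :
    divDiff i p (∑ k ∈ s, g k) = ∑ k ∈ s, divDiff i p (g k) :=
  map_sum (AddMonoidHom.mk' (divDiff i p) (divDiff_add i p)) g s

/-- The summands `i = j` and `i = j + 1` give `insertAt (j + 1) 0 (g j)` and `-insertAt j 0 (g (j +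
1))`. Telescoping turns these into `g j` and `-insertAt 0 0 (g (j + 1))`, as `insertAt (M - 1) 0`
fixes `g j`. What remains is a combination of the commutation defects of `g`. -/
theorem divDiff_sum_X_mul {g : ℕ → MvPolynomial ℕ A} {j M : ℕ} (hM : j + 2 ≤ M)
    (hvars : ∀ k ∈ (g j).vars, k < M - 1) :
    divDiff j 0 (∑ i ∈ Finset.range M, X i * g i) - (g j - insertAt 0 0 (g (j + 1))) =
      ∑ i ∈ Finset.Ico 0 j, X i * (divDiff j 0 (g i) - divDiff i 0 (g (j + 1))) +
      ∑ i ∈ Finset.Ico (j + 1) (M - 1), X i * (divDiff j 0 (g (i + 1)) - divDiff i 0 (g j)) := by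
  have e1 : ∑ i ∈ Finset.Ico 0 j, divDiff j 0 (X i * g i) =
      ∑ i ∈ Finset.Ico 0 j, X i * divDiff j 0 (g i) :=
    Finset.sum_congr rfl fun i hi => by
      rw [divDiff_X_mul, if_pos (Finset.mem_Ico.1 hi).2]
  have e2 : ∑ i ∈ Finset.Ico (j + 1 + 1) (M - 1 + 1), divDiff j 0 (X i * g i) =
      ∑ i ∈ Finset.Ico (j + 1) (M - 1), X i * divDiff j 0 (g (i + 1)) := by
    rw [← Finset.sum_Ico_add' _ _ _ 1]
    refine Finset.sum_congr rfl fun i hi => ?_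
    have := Finset.mem_Ico.1 hi
    rw [divDiff_X_mul, if_neg (by omega), if_neg (by omega), if_neg (by omega),
      Nat.add_sub_cancel]
  have e3 : divDiff j 0 (X j * g j) = insertAt (j + 1) 0 (g j) := by
    rw [divDiff_X_mul, if_neg (by omega), if_pos rfl]
  have e4 : divDiff j 0 (X (j + 1) * g (j + 1)) = - insertAt j 0 (g (j + 1)) := by
    rw [divDiff_X_mul, if_neg (by omega), if_neg (by omega), if_pos rfl]
  have e5 := sum_X_mul_divDiff (g (j + 1)) (Nat.zero_le j)
  have e6 := sum_X_mul_divDiff (g j) (show j + 1 ≤ M - 1 by omega)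
  rw [insertAt_eq_self hvars le_rfl] at e6
  rw [divDiff_sum, Finset.range_eq_Ico, show M = M - 1 + 1 by omega,
    ← Finset.sum_Ico_consecutive _ (Nat.zero_le j) (show j ≤ M - 1 + 1 by omega),
    Finset.sum_eq_sum_Ico_succ_bot (show j < M - 1 + 1 by omega),
    Finset.sum_eq_sum_Ico_succ_bot (show j + 1 < M - 1 + 1 by omega), e1, e2, e3, e4]
  simp only [mul_sub, Finset.sum_sub_distrib, Nat.add_sub_cancel, e5, e6]
  ring

/-- The integral is `∑ X i * g i` plus an integral of the shifted family `insertAt 0 0 (g (i + 1))`,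
whose support is shorter by one: by `divDiff_sum_X_mul` the sum has the divided differences `g j -
insertAt 0 0 (g (j + 1))` up to lower degree. -/
theorem exists_approx_integral (d N : ℕ) : ∀ g : ℕ → MvPolynomial ℕ A,
    (∀ i, g i ∈ degreeLT A (d + 1)) → (∀ i, N ≤ i → g i = 0) →
    (∀ i j, i + 1 < j → divDiff i 0 (g j) - divDiff (j - 1) 0 (g i) ∈ degreeLT A (d - 1)) →
    ∃ f ∈ degreeLT A (d + 2), ∀ j, divDiff j 0 f - g j ∈ degreeLT A d := by
  induction N with
  | zero =>
    intro g _ h0 _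
    refine ⟨0, zero_mem _, fun j => ?_⟩
    rw [h0 j (Nat.zero_le j), divDiff_zero, sub_zero]
    exact zero_mem _
  | succ N ih =>
    intro g hg h0 hcomp
    obtain ⟨f, hf, hfg⟩ := ih (fun i => insertAt 0 0 (g (i + 1)))
      (fun i => insertAt_mem_degreeLT 0 (hg _))
      (fun i hi => by rw [h0 _ (by omega), map_zero])
      (fun i j hij => by
        rw [divDiff_insertAt (Nat.zero_le i), divDiff_insertAt (Nat.zero_le _), ← map_sub,
          show j - 1 + 1 = j + 1 - 1 by omega]
        exact insertAt_mem_degreeLT 0 (hcomp _ _ (by omega)))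
    -- The truncated `d - 1` is harmless: for `d = 0` it forces `u = 0`.
    have hX : ∀ (i : ℕ) (u : MvPolynomial ℕ A), u ∈ degreeLT A (d - 1) →
        X i * u ∈ degreeLT A d := by
      intro i u hu
      cases d with
      | zero => rw [mem_degreeLT_zero.1 hu, mul_zero]; exact zero_mem _
      | succ d => exact X_mul_mem_degreeLT i hu
    refine ⟨f + ∑ i ∈ Finset.range (N + 1), X i * g i,
      add_mem hf (sum_mem fun i _ => X_mul_mem_degreeLT i (hg i)), fun j => ?_⟩
    obtain ⟨n, hn⟩ := exists_vars_lt (g j)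
    -- The range is extended by zero terms beyond `j + 1` and beyond all variables of `g j`.
    have hsum : ∑ i ∈ Finset.range (N + 1), X i * g i =
        ∑ i ∈ Finset.range (N + 1 + n + j + 2), X i * g i := by
      refine Finset.sum_subset (fun i hi => ?_) (fun i _ hi => ?_)
      · rw [Finset.mem_range] at *; omega
      · rw [Finset.mem_range, not_lt] at hi
        rw [h0 i hi, mul_zero]
    have key := divDiff_sum_X_mul (g := g) (j := j) (M := N + 1 + n + j + 2) (by omega)
      (fun k hk => (hn k hk).trans_le (by omega))
    have e : divDiff j 0 (f + ∑ i ∈ Finset.range (N + 1), X i * g i) - g j =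
        (divDiff j 0 f - insertAt 0 0 (g (j + 1))) +
        (divDiff j 0 (∑ i ∈ Finset.range (N + 1), X i * g i) -
          (g j - insertAt 0 0 (g (j + 1)))) := by
      rw [divDiff_add]; ring
    rw [e, hsum, key]
    refine add_mem (hfg j) (add_mem (sum_mem fun i hi => hX _ _ ?_) (sum_mem fun i hi => hX _ _ ?_))
    · rw [← neg_sub, neg_mem_iff]
      exact hcomp i (j + 1) (by have := Finset.mem_Ico.1 hi; omega)
    · exact hcomp j (i + 1) (by have := Finset.mem_Ico.1 hi; omega)

/-- A finitely supported family `g` is the family of divided differences of a polynomial if it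
satisfies the commutation relations between divided differences. -/
theorem exists_integral (t : ℕ → A) (g : ℕ → MvPolynomial ℕ A) (N : ℕ)
    (hN : ∀ i, N ≤ i → g i = 0)
    (hcomp : ∀ i j, i + 1 < j → divDiff i (t i) (g j) = divDiff (j - 1) (t j) (g i)) :
    ∃ f, ∀ i, divDiff i (t i) f = g i := by
  obtain ⟨d, hd⟩ : ∃ d, ∀ i, g i ∈ degreeLT A d := by
    refine ⟨(Finset.range N).sup (fun i => (g i).totalDegree) + 1, fun i => ?_⟩
    rw [mem_degreeLT_succ]
    by_cases hi : i < N
    · exact Finset.le_sup (f := fun i => (g i).totalDegree) (Finset.mem_range.2 hi)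
    · rw [hN i (by omega), totalDegree_zero]; exact Nat.zero_le _
  induction d generalizing g N with
  | zero =>
    refine ⟨0, fun i => ?_⟩
    rw [divDiff_zero, mem_degreeLT_zero.1 (hd i)]
  | succ d ih =>
    -- Replacing the scalars by `0` turns the exact commutation relation into one modulo lower
    -- degree.
    obtain ⟨f, hf, hfg⟩ := exists_approx_integral d N g hd hN fun i j hij => by
      have h1 := divDiff_sub_mem_degreeLT' (i := i) 0 (t i) (hd j)
      have h2 := divDiff_sub_mem_degreeLT' (i := j - 1) (t j) 0 (hd i)
      have := add_mem h1 h2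
      rwa [hcomp i j hij, sub_add_sub_cancel] at this
    obtain ⟨n, hn⟩ := exists_vars_lt f
    -- The remainder has lower degree, and vanishes once `i` exceeds the support of `g` and the
    -- variables of `f`.
    obtain ⟨f', hf'⟩ := ih (fun i => g i - divDiff i (t i) f) (max N n)
      (fun i hi => by
        have h1 : divDiff i (t i) f = 0 := by
          rw [divDiff_eq_iff, insertAt_eq_self hn (by omega), insertAt_eq_self hn (by omega)]
          simp
        rw [hN i (by omega), h1, sub_zero])
      (fun i j hij => by
        rw [divDiff_sub, divDiff_sub, hcomp i j hij, divDiff_comm hij])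
      (fun i => by
        have h1 := divDiff_sub_mem_degreeLT (i := i) 0 (t i) hf
        have := sub_mem h1 (hfg i)
        rwa [sub_sub_sub_cancel_left] at this)
    exact ⟨f' + f, fun i => by rw [divDiff_add, hf', sub_add_cancel]⟩

end Integration
/-! ### Codes of trees -/

/-- The code of the trimmed forest in terms of the code of the forest. -/
def trimSeq (c : ℕ → ℕ) (i k : ℕ) : ℕ :=
  if k < i then c k else if k = i then c i - 1 else c (k + 1)

/-- The descents of a code, which are the labels of the terminal nodes. -/
def seqDes (c : ℕ → ℕ) : Set ℕ := {i | 0 < c i ∧ c (i + 1) = 0}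

theorem treeCode_of_ge (T : BinaryTree Unit) :
    ∀ a i, a + T.numLeaves ≤ i + 1 → treeCode T a i = 0 := by
  induction T with
  | nil => intros; rfl
  | node _ l r hl hr =>
    intro a i h
    have h1 := l.numLeaves_pos
    have h2 := r.numLeaves_pos
    rw [BinaryTree.numLeaves] at h
    rw [treeCode, hl a i (by omega), hr _ i (by omega), if_neg (by omega)]

theorem treeCode_self_pos {T : BinaryTree Unit} (h : T ≠ .nil) (a : ℕ) : 0 < treeCode T a a := by
  cases T with
  | nil => exact absurd rfl h
  | node _ l r => rw [treeCode, if_pos rfl]; omega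

theorem treeQDes_node {l r : BinaryTree Unit} (h : ¬ (l = .nil ∧ r = .nil)) (u : Unit) (a : ℕ) :
    treeQDes (.node u l r) a = treeQDes l a ∪ treeQDes r (a + l.numLeaves) := by
  cases l <;> cases r <;> simp_all [treeQDes]

theorem treeTrim_node {l r : BinaryTree Unit} (h : ¬ (l = .nil ∧ r = .nil)) (u : Unit)
    (a i : ℕ) : treeTrim (.node u l r) a i =
      .node () (treeTrim l a i) (treeTrim r (a + l.numLeaves) i) := by
  cases l <;> cases r <;> simp_all [treeTrim]

theorem one_lt_numLeaves {T : BinaryTree Unit} (h : T ≠ .nil) : 1 < T.numLeaves := by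
  cases T with
  | nil => exact absurd rfl h
  | node _ l r =>
    have h1 := l.numLeaves_pos
    have h2 := r.numLeaves_pos
    rw [BinaryTree.numLeaves]; omega

/-- The nodes with `ρ(v) = i` form a left path ending at the leaf `i`. The right subtree of the
lowest one starts at the leaf `i + 1`, so it is trivial exactly when the entry at `i + 1` is zero.
-/
theorem treeQDes_eq (T : BinaryTree Unit) : ∀ a, treeQDes T a = seqDes (treeCode T a) := by
  induction T with
  | nil => intro a; simp [treeQDes, seqDes, treeCode]
  | node u l r hl hr =>
    intro a
    ext i
    by_cases hnil : l = .nil ∧ r = .nil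
    · obtain ⟨rfl, rfl⟩ := hnil
      simp only [treeQDes, seqDes, treeCode, Set.mem_singleton_iff, Set.mem_ofPred_eq, add_zero]
      constructor
      · rintro rfl; simp
      · rintro ⟨h, -⟩
        by_contra hne
        rw [if_neg hne] at h; omega
    · rw [treeQDes_node hnil, hl, hr]
      have hL := l.numLeaves_pos
      simp only [seqDes, Set.mem_union, Set.mem_ofPred_eq, treeCode]
      rcases lt_trichotomy i a with hi | rfl | hi
      · rw [treeCode_of_lt l _ _ hi, treeCode_of_lt r _ i (by omega), if_neg hi.ne]
        simp
      · rw [if_pos rfl, if_neg (by omega), treeCode_of_lt r _ i (by omega)]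
        by_cases hln : l = .nil
        · subst hln
          have := treeCode_self_pos (T := r) (fun h => hnil ⟨rfl, h⟩) (i + 1)
          simp only [treeCode, BinaryTree.numLeaves]
          omega
        · have := treeCode_self_pos hln i
          have := one_lt_numLeaves hln
          rw [treeCode_of_lt r _ (i + 1) (by omega)]
          omega
      · rw [if_neg hi.ne', if_neg (by omega)]
        rcases Nat.lt_or_ge (i + 1) (a + l.numLeaves) with h | h
        · rw [treeCode_of_lt r _ i (by omega), treeCode_of_lt r _ (i + 1) (by omega)]
          omega
        · rw [treeCode_of_ge l _ i (by omega), treeCode_of_ge l _ (i + 1) (by omega)]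
          omega

theorem treeQDes_bounds {T : BinaryTree Unit} {a i : ℕ} (h : i ∈ treeQDes T a) :
    a ≤ i ∧ i + 1 < a + T.numLeaves := by
  rw [treeQDes_eq] at h
  constructor
  · by_contra hcon
    have := treeCode_of_lt T a i (by omega)
    have := h.1
    omega
  · by_contra hcon
    have := treeCode_of_ge T a i (by omega)
    have := h.1
    omega

theorem treeTrim_of_notMem (T : BinaryTree Unit) :
    ∀ a i, i ∉ treeQDes T a → treeTrim T a i = T := by
  induction T with
  | nil => intros; rfl
  | node u l r hl hr =>
    intro a i h
    by_cases hnil : l = .nil ∧ r = .nil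
    · obtain ⟨rfl, rfl⟩ := hnil
      exact if_neg h
    · rw [treeQDes_node hnil, Set.mem_union, not_or] at h
      rw [treeTrim_node hnil, hl _ _ h.1, hr _ _ h.2]

/-- One node leaves the left path of `i`, the leaf `i + 1` with its zero entry disappears, and all
later labels drop by one. -/
theorem treeTrim_of_mem (T : BinaryTree Unit) : ∀ a i, i ∈ treeQDes T a →
    (treeTrim T a i).numLeaves + 1 = T.numLeaves ∧
      ∀ k, treeCode (treeTrim T a i) a k = trimSeq (treeCode T a) i k := by
  induction T with
  | nil => intro a i h; exact h.elim
  | node u l r hl hr =>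
    intro a i h
    by_cases hnil : l = .nil ∧ r = .nil
    · obtain ⟨rfl, rfl⟩ := hnil
      obtain rfl : i = a := h
      rw [treeTrim, if_pos rfl]
      refine ⟨rfl, fun k => ?_⟩
      simp only [trimSeq, treeCode]
      split_ifs <;> omega
    · rw [treeQDes_node hnil] at h
      rw [treeTrim_node hnil]
      have hL := l.numLeaves_pos
      rcases h with h | h
      · obtain ⟨h1, h2⟩ := treeQDes_bounds h
        have hr' : i ∉ treeQDes r (a + l.numLeaves) := fun h' => by
          have := (treeQDes_bounds h').1; omega
        obtain ⟨h3, h4⟩ := hl a i h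
        have hpos : 0 < treeCode l a i := ((treeQDes_eq l a) ▸ h).1
        rw [treeTrim_of_notMem _ _ _ hr']
        refine ⟨by simp only [BinaryTree.numLeaves]; omega, fun k => ?_⟩
        have e := treeCode_succ r (a + (treeTrim l a i).numLeaves) k
        rw [add_assoc, h3] at e
        simp only [trimSeq, treeCode, h4, ← e]
        rcases lt_trichotomy k i with hk | rfl | hk
        · rw [if_pos hk, if_pos hk, treeCode_of_lt r _ (k + 1) (by omega),
            treeCode_of_lt r _ k (by omega)]
        · rw [if_neg (lt_irrefl _), if_pos rfl, if_neg (lt_irrefl _), if_pos rfl,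
            treeCode_of_lt r _ (k + 1) (by omega), treeCode_of_lt r _ k (by omega)]
          omega
        · rw [if_neg hk.not_gt, if_neg hk.ne', if_neg hk.not_gt, if_neg hk.ne',
            if_neg (show ¬ k = a by omega), if_neg (show ¬ k + 1 = a by omega)]
      · obtain ⟨h1, h2⟩ := treeQDes_bounds h
        have hl' : i ∉ treeQDes l a := fun h' => by
          have := (treeQDes_bounds h').2; omega
        obtain ⟨h3, h4⟩ := hr _ i h
        have hpos : 0 < treeCode r (a + l.numLeaves) i := ((treeQDes_eq r _) ▸ h).1
        rw [treeTrim_of_notMem _ _ _ hl']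
        refine ⟨by simp only [BinaryTree.numLeaves]; omega, fun k => ?_⟩
        simp only [trimSeq, treeCode, h4]
        rcases lt_trichotomy k i with hk | rfl | hk
        · rw [if_pos hk, if_pos hk]
        · rw [if_neg (lt_irrefl _), if_pos rfl, if_neg (lt_irrefl _), if_pos rfl]
          rw [if_neg (by omega), treeCode_of_ge l _ k (by omega)]
          omega
        · rw [if_neg hk.not_gt, if_neg hk.ne', if_neg hk.not_gt, if_neg hk.ne',
            if_neg (show ¬ k = a by omega), if_neg (show ¬ k + 1 = a by omega),
            treeCode_of_ge l _ k (by omega), treeCode_of_ge l _ (k + 1) (by omega)]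

/-! ### Codes of forests -/

namespace IndexedForest

theorem firstLeaf_succ (F : IndexedForest) (j : ℕ) :
    F.firstLeaf (j + 1) = F.firstLeaf j + (F.tree j).numLeaves :=
  Finset.sum_range_succ _ _

theorem firstLeaf_mono (F : IndexedForest) {j k : ℕ} (h : j ≤ k) :
    F.firstLeaf j ≤ F.firstLeaf k :=
  Finset.sum_le_sum_of_subset (Finset.range_mono h)

theorem exists_tree_of_leaf (F : IndexedForest) (i : ℕ) :
    ∃ j, F.firstLeaf j ≤ i ∧ i < F.firstLeaf (j + 1) := by
  induction i with
  | zero =>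
    refine ⟨0, le_rfl, ?_⟩
    rw [firstLeaf_succ]
    have := (F.tree 0).numLeaves_pos
    omega
  | succ i ih =>
    obtain ⟨j, h1, h2⟩ := ih
    rcases Nat.lt_or_ge (i + 1) (F.firstLeaf (j + 1)) with h | h
    · exact ⟨j, by omega, h⟩
    · refine ⟨j + 1, h, ?_⟩
      rw [firstLeaf_succ F (j + 1)]
      have := (F.tree (j + 1)).numLeaves_pos
      omega

theorem code_eq (F : IndexedForest) {i j : ℕ} (h1 : F.firstLeaf j ≤ i)
    (h2 : i < F.firstLeaf (j + 1)) : F.code i = treeCode (F.tree j) (F.firstLeaf j) i := by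
  have hj := F.le_firstLeaf j
  refine Finset.sum_eq_single_of_mem j (Finset.mem_range.2 (by omega)) fun k _ hk => ?_
  rcases Nat.lt_or_gt_of_ne hk with hk | hk
  · have := F.firstLeaf_mono (Nat.succ_le_of_lt hk)
    rw [Nat.succ_eq_add_one, firstLeaf_succ] at this
    exact treeCode_of_ge _ _ _ (by omega)
  · have := F.firstLeaf_mono (Nat.succ_le_of_lt hk)
    rw [Nat.succ_eq_add_one] at this
    exact treeCode_of_lt _ _ _ (by omega)

theorem mem_treeQDes_iff (F : IndexedForest) {i j : ℕ} (h1 : F.firstLeaf j ≤ i)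
    (h2 : i < F.firstLeaf (j + 1)) :
    i ∈ treeQDes (F.tree j) (F.firstLeaf j) ↔ i ∈ seqDes F.code := by
  rw [treeQDes_eq]
  simp only [seqDes, Set.mem_ofPred_eq, F.code_eq h1 h2]
  rcases Nat.lt_or_ge (i + 1) (F.firstLeaf (j + 1)) with h | h
  · rw [F.code_eq (by omega) h]
  -- The last leaf of a tree has entry `0`, so both sides are false and the next tree plays no role.
  · rw [firstLeaf_succ] at h
    rw [treeCode_of_ge (F.tree j) _ i h]
    omega

theorem qdes_eq (F : IndexedForest) : F.qdes = seqDes F.code := by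
  ext i
  constructor
  · rintro ⟨j, hj⟩
    have h := treeQDes_bounds hj
    rw [← firstLeaf_succ] at h
    exact (F.mem_treeQDes_iff h.1 (by omega)).1 hj
  · intro h
    obtain ⟨j, h1, h2⟩ := F.exists_tree_of_leaf i
    exact ⟨j, (F.mem_treeQDes_iff h1 h2).2 h⟩

theorem firstLeaf_trim (F : IndexedForest) {i j : ℕ}
    (hj : i ∈ treeQDes (F.tree j) (F.firstLeaf j)) (k : ℕ) :
    (F.trim i).firstLeaf k = if k ≤ j then F.firstLeaf k else F.firstLeaf k - 1 := by
  have hb := treeQDes_bounds hj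
  induction k with
  | zero => rfl
  | succ k ih =>
    rw [firstLeaf_succ, ih, F.firstLeaf_succ k]
    have hpos := (F.tree k).numLeaves_pos
    change _ + (treeTrim (F.tree k) (F.firstLeaf k) i).numLeaves = _
    rcases lt_trichotomy k j with h | rfl | h
    · have := F.firstLeaf_mono (Nat.succ_le_of_lt h)
      rw [Nat.succ_eq_add_one, firstLeaf_succ] at this
      rw [treeTrim_of_notMem _ _ _ (fun h' => by have := treeQDes_bounds h'; omega),
        if_pos (by omega), if_pos (by omega)]
    · have := (treeTrim_of_mem _ _ _ hj).1
      rw [if_pos le_rfl, if_neg (by omega)]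
      omega
    · have := F.firstLeaf_mono (Nat.succ_le_of_lt h)
      rw [Nat.succ_eq_add_one, firstLeaf_succ] at this
      rw [treeTrim_of_notMem _ _ _ (fun h' => by have := treeQDes_bounds h'; omega),
        if_neg (by omega), if_neg (by omega)]
      omega

theorem code_trim (F : IndexedForest) {i : ℕ} (hi : i ∈ F.qdes) :
    (F.trim i).code = trimSeq F.code i := by
  obtain ⟨j, hj⟩ := hi
  have hb := treeQDes_bounds hj
  have hfl := F.firstLeaf_trim hj
  funext k
  obtain ⟨m, h1, h2⟩ := (F.trim i).exists_tree_of_leaf k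
  rw [code_eq _ h1 h2]
  change treeCode (treeTrim (F.tree m) (F.firstLeaf m) i) _ k = _
  rw [hfl] at h1 h2 ⊢
  have hsucc := F.firstLeaf_succ m
  have hpos := (F.tree m).numLeaves_pos
  rcases lt_trichotomy m j with h | rfl | h
  · have := F.firstLeaf_mono (Nat.succ_le_of_lt h)
    rw [Nat.succ_eq_add_one] at this
    rw [if_pos h.le] at h1 ⊢
    rw [if_pos (by omega)] at h2
    rw [treeTrim_of_notMem _ _ _ (fun h' => by have := treeQDes_bounds h'; omega), trimSeq,
      if_pos (by omega), F.code_eq h1 h2]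
  · rw [if_pos le_rfl] at h1 ⊢
    rw [if_neg (by omega)] at h2
    rw [(treeTrim_of_mem _ _ _ hj).2, trimSeq, trimSeq, F.code_eq h1 (by omega),
      F.code_eq hb.1 (by omega), F.code_eq (i := k + 1) (j := m) (by omega) (by omega)]
  · have := F.firstLeaf_mono (Nat.succ_le_of_lt h)
    rw [Nat.succ_eq_add_one, firstLeaf_succ] at this
    rw [if_neg (by omega)] at h1 h2 ⊢
    rw [treeTrim_of_notMem _ _ _ (fun h' => by have := treeQDes_bounds h'; omega), trimSeq,
      if_neg (by omega), if_neg (by omega), F.code_eq (i := k + 1) (j := m) (by omega) (by omega),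
      ← treeCode_succ, Nat.sub_add_cancel (by omega)]

theorem code_empty : empty.code = 0 := by
  funext i
  simp [code, empty, treeCode]

theorem eq_empty_of_code (F : IndexedForest) (h : F.code = 0) : F = empty := by
  refine IndexedForest.ext (funext fun j => ?_)
  by_contra hne
  have h1 := treeCode_self_pos hne (F.firstLeaf j)
  have h2 := (F.tree j).numLeaves_pos
  rw [← F.code_eq le_rfl (by rw [firstLeaf_succ]; omega), h] at h1
  exact absurd h1 (by simp)

theorem exists_code_eq_zero (F : IndexedForest) : ∃ N, ∀ i, N ≤ i → F.code i = 0 := by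
  obtain ⟨m, hm⟩ := F.finite.bddAbove
  refine ⟨F.firstLeaf (m + 1), fun i hi => ?_⟩
  obtain ⟨j, h1, h2⟩ := F.exists_tree_of_leaf i
  have hj : F.tree j = .nil := by
    by_contra hne
    have := F.firstLeaf_mono (Nat.succ_le_succ (hm hne))
    simp only [Nat.succ_eq_add_one] at this
    omega
  rw [F.code_eq h1 h2, hj, treeCode]

end IndexedForest

/-! ### Sizes of codes -/

/-- The sequence `c` has finite support and sum `d`. -/
def HasSize (c : ℕ → ℕ) (d : ℕ) : Prop :=
  ∃ N, (∀ i, N ≤ i → c i = 0) ∧ ∑ i ∈ Finset.range N, c i = d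

theorem HasSize.sum_eq {c : ℕ → ℕ} {d N : ℕ} (h : HasSize c d) (hN : ∀ i, N ≤ i → c i = 0) :
    ∑ i ∈ Finset.range N, c i = d := by
  obtain ⟨M, hM, rfl⟩ := h
  have key : ∀ N M : ℕ, (∀ i, N ≤ i → c i = 0) →
      ∑ i ∈ Finset.range N, c i = ∑ i ∈ Finset.range (max N M), c i := fun N M hN => by
    refine Finset.sum_subset (Finset.range_mono (le_max_left _ _)) fun i _ hi => hN i ?_
    simpa using hi
  rw [key N M hN, key M N hM, max_comm]

theorem HasSize.eq {c : ℕ → ℕ} {d e : ℕ} (h : HasSize c d) (h' : HasSize c e) : d = e := by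
  obtain ⟨N, hN, rfl⟩ := h
  exact h'.sum_eq hN

theorem HasSize.eq_zero {c : ℕ → ℕ} (h : HasSize c 0) : c = 0 := by
  obtain ⟨N, hN, h⟩ := h
  funext i
  rcases Nat.lt_or_ge i N with hi | hi
  · exact Finset.sum_eq_zero_iff.1 h i (Finset.mem_range.2 hi)
  · exact hN i hi

theorem hasSize_zero : HasSize 0 0 := ⟨0, fun _ _ => rfl, rfl⟩

/-- At a descent the deleted entry `c (i + 1)` is zero, so only the unit taken from `c i` is lost.
-/
theorem HasSize.trimSeq {c : ℕ → ℕ} {d i : ℕ} (h : HasSize c (d + 1)) (hi : i ∈ seqDes c) :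
    HasSize (trimSeq c i) d := by
  obtain ⟨N, hN, -⟩ := id h
  have hN' : ∀ k, i + 2 + N ≤ k → c k = 0 := fun k hk => hN k (by omega)
  have hs := h.sum_eq hN'
  refine ⟨i + 1 + N, fun k hk => ?_, ?_⟩
  · rw [EQSymNC.trimSeq, if_neg (by omega), if_neg (by omega)]
    exact hN _ (by omega)
  · rw [Finset.sum_range_add, Finset.sum_range_succ, Finset.sum_range_succ] at hs
    rw [Finset.sum_range_add, Finset.sum_range_succ]
    have e1 : ∑ k ∈ Finset.range i, EQSymNC.trimSeq c i k = ∑ k ∈ Finset.range i, c k :=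
      Finset.sum_congr rfl fun k hk => if_pos (Finset.mem_range.1 hk)
    have e2 : ∑ k ∈ Finset.range N, EQSymNC.trimSeq c i (i + 1 + k) =
        ∑ k ∈ Finset.range N, c (i + 2 + k) :=
      Finset.sum_congr rfl fun k _ => by
        rw [EQSymNC.trimSeq, if_neg (by omega), if_neg (by omega)]
        congr 1; omega
    have e3 : EQSymNC.trimSeq c i i = c i - 1 := by
      rw [EQSymNC.trimSeq, if_neg (by omega), if_pos rfl]
    have := hi.1
    have := hi.2
    omega

theorem trimSeq_trimSeq {c : ℕ → ℕ} {i j : ℕ} (h : i + 1 < j) :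
    trimSeq (trimSeq c j) i = trimSeq (trimSeq c i) (j - 1) := by
  funext k
  have h1 : j - 1 + 1 = j := by omega
  simp only [trimSeq]
  rcases lt_trichotomy k i with hk | rfl | hk
  · simp [hk, show k < j by omega, show k < j - 1 by omega]
  · simp [show k < j by omega, show k < j - 1 by omega]
  · rcases lt_trichotomy k (j - 1) with hk' | rfl | hk'
    · simp [hk.not_gt, hk.ne', show k + 1 < j by omega, show k < j - 1 by omega]
    · simp [hk.not_gt, hk.ne', h1]
    · simp [hk.not_gt, hk.ne', hk'.not_gt, hk'.ne', show ¬ k + 1 < j by omega,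
        show ¬ k + 1 = j by omega, show ¬ k + 1 < i by omega, show ¬ k + 1 = i by omega]

theorem mem_seqDes_trimSeq_of_lt {c : ℕ → ℕ} {i j : ℕ} (h : i + 1 < j) :
    i ∈ seqDes (trimSeq c j) ↔ i ∈ seqDes c := by
  simp only [seqDes, Set.mem_ofPred_eq, trimSeq]
  rw [if_pos (by omega), if_pos (by omega)]

theorem mem_seqDes_trimSeq_of_gt {c : ℕ → ℕ} {i j : ℕ} (h : i + 1 < j) :
    j - 1 ∈ seqDes (trimSeq c i) ↔ j ∈ seqDes c := by
  simp only [seqDes, Set.mem_ofPred_eq, trimSeq]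
  rw [if_neg (by omega), if_neg (by omega), if_neg (by omega), if_neg (by omega),
    Nat.sub_add_cancel (by omega)]

/-! ### Divided differences in two sets of variables -/

/-- Put `t k` in position `i` and move the later `x`-variables one position to the right. -/
noncomputable def insT (i k : ℕ) : Poly →ₐ[ℤ] Poly :=
  MvPolynomial.aeval (Sum.elim
    (fun j => if j < i then x j else if j = i then t k else x (j - 1)) t)

/-- The variant of `IsDividedDifference i` in which `t k` is inserted. -/
def IsDivDiff (i k : ℕ) (f g : Poly) : Prop :=
  insT (i + 1) k f - insT i k f = (x i - t k) * g

theorem isDividedDifference_iff {i : ℕ} {f g : Poly} :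
    IsDividedDifference i f g ↔ IsDivDiff i i f g := Iff.rfl

theorem isDivDiff_zero (i k : ℕ) : IsDivDiff i k 0 0 := by
  simp [IsDivDiff]

theorem sumAlgEquiv_insT (i k : ℕ) (f : Poly) :
    MvPolynomial.sumAlgEquiv ℤ ℕ ℕ (insT i k f) =
      insertAt i (MvPolynomial.X k) (MvPolynomial.sumAlgEquiv ℤ ℕ ℕ f) := by
  suffices (MvPolynomial.sumAlgEquiv ℤ ℕ ℕ).toAlgHom.comp (insT i k) =
      ((insertAt i (MvPolynomial.X k : MvPolynomial ℕ ℤ)).restrictScalars ℤ).comp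
        (MvPolynomial.sumAlgEquiv ℤ ℕ ℕ).toAlgHom from DFunLike.congr_fun this f
  refine MvPolynomial.algHom_ext fun j => ?_
  rcases j with j | j
  · simp only [insT, AlgHom.comp_apply, MvPolynomial.aeval_X, Sum.elim_inl, insertAt, x, t,
      AlgEquiv.toAlgHom_apply, MvPolynomial.sumAlgEquiv_X_inl,
      AlgHom.restrictScalars_apply]
    split_ifs <;> simp
  · simp [insT, insertAt, t]

theorem isDivDiff_iff {i k : ℕ} {f g : Poly} : IsDivDiff i k f g ↔
    divDiff i (MvPolynomial.X k) (MvPolynomial.sumAlgEquiv ℤ ℕ ℕ f) =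
      MvPolynomial.sumAlgEquiv ℤ ℕ ℕ g := by
  rw [divDiff_eq_iff, ← sumAlgEquiv_insT, ← sumAlgEquiv_insT, IsDivDiff,
    ← (MvPolynomial.sumAlgEquiv ℤ ℕ ℕ).injective.eq_iff, eq_comm]
  simp [x, t]

/-- In the commutation relation `t j` is inserted at position `j - 1`; position and label therefore
have to be separate in `IsDivDiff`. -/
theorem exists_isDividedDifference (g : ℕ → Poly) (N : ℕ) (hN : ∀ i, N ≤ i → g i = 0)
    (hcomp : ∀ i j, i + 1 < j → ∃ h, IsDivDiff i i (g j) h ∧ IsDivDiff (j - 1) j (g i) h) :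
    ∃ f, ∀ i, IsDividedDifference i f (g i) := by
  obtain ⟨f, hf⟩ := exists_integral (fun i => (MvPolynomial.X i : MvPolynomial ℕ ℤ))
    (fun i => MvPolynomial.sumAlgEquiv ℤ ℕ ℕ (g i)) N
    (fun i hi => by rw [hN i hi, map_zero])
    (fun i j hij => by
      obtain ⟨h, h1, h2⟩ := hcomp i j hij
      rw [isDivDiff_iff.1 h1, isDivDiff_iff.1 h2])
  refine ⟨(MvPolynomial.sumAlgEquiv ℤ ℕ ℕ).symm f, fun i => ?_⟩
  rw [isDividedDifference_iff, isDivDiff_iff, AlgEquiv.apply_symm_apply]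
  exact hf i

/-! ### Omitting a `t`-variable -/

theorem omitT_x (j k : ℕ) : omitT j (x k) = x k := by simp [omitT, x]

theorem omitT_t (j k : ℕ) : omitT j (t k) = if k < j then t k else t (k + 1) := by
  simp [omitT, t]

theorem omitT_insT {j k l : ℕ} (h : omitT j (t k) = t l) (i : ℕ) (f : Poly) :
    omitT j (insT i k f) = insT i l (omitT j f) := by
  suffices (omitT j).comp (insT i k) = (insT i l).comp (omitT j) from DFunLike.congr_fun this f
  refine MvPolynomial.algHom_ext fun m => ?_
  have hx : ∀ i k m, insT i k (x m) = if m < i then x m else if m = i then t k else x (m - 1) :=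
    fun i k m => by simp [insT, x]
  have ht : ∀ i k m, insT i k (t m) = t m := fun i k m => by simp [insT, t]
  rcases m with m | m
  · change omitT j (insT i k (x m)) = insT i l (omitT j (x m))
    rw [omitT_x, hx, hx]
    split_ifs
    · rw [omitT_x]
    · exact h
    · rw [omitT_x]
  · change omitT j (insT i k (t m)) = insT i l (omitT j (t m))
    rw [ht, omitT_t]
    split_ifs <;> rw [ht]

theorem IsDivDiff.omitT {i j k l : ℕ} {f g : Poly} (h : IsDivDiff i k f g)
    (hk : EQSymNC.omitT j (t k) = t l) :
    IsDivDiff i l (EQSymNC.omitT j f) (EQSymNC.omitT j g) := by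
  rw [IsDivDiff, ← omitT_insT hk, ← omitT_insT hk, ← map_sub, h, map_mul, map_sub, hk, omitT_x]

theorem omitT_comm {i j : ℕ} (h : i < j) (f : Poly) :
    omitT j (omitT i f) = omitT i (omitT (j - 1) f) := by
  suffices (omitT j).comp (omitT i) = (omitT i).comp (omitT (j - 1)) from
    DFunLike.congr_fun this f
  refine MvPolynomial.algHom_ext fun m => ?_
  rcases m with m | m
  · change omitT j (omitT i (x m)) = omitT i (omitT (j - 1) (x m))
    simp only [omitT_x]
  · change omitT j (omitT i (t m)) = omitT i (omitT (j - 1) (t m))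
    rw [omitT_t, omitT_t]
    split_ifs <;> simp only [omitT_t] <;> split_ifs <;> first | rfl | omega

/-! ### Homogeneity -/

/-- Allows an arbitrary integral to be replaced by its component of the right degree. -/
theorem homogeneousComponent_aeval {σ τ : Type*} {φ : σ → MvPolynomial τ ℤ}
    (hφ : ∀ k, (φ k).IsHomogeneous 1) (n : ℕ) (f : MvPolynomial σ ℤ) :
    MvPolynomial.homogeneousComponent n (MvPolynomial.aeval φ f) =
      MvPolynomial.aeval φ (MvPolynomial.homogeneousComponent n f) := by
  have key : ∀ m, MvPolynomial.homogeneousComponent n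
      (MvPolynomial.aeval φ (MvPolynomial.homogeneousComponent m f)) =
      if n = m then MvPolynomial.aeval φ (MvPolynomial.homogeneousComponent n f) else 0 := by
    intro m
    have h := (MvPolynomial.homogeneousComponent_isHomogeneous m f).aeval φ hφ
    rw [one_mul] at h
    rw [MvPolynomial.homogeneousComponent_of_mem h]
    split_ifs with e
    · rw [e]
    · rfl
  conv_lhs => rw [← MvPolynomial.sum_homogeneousComponent f]
  rw [map_sum, map_sum, Finset.sum_congr rfl fun m _ => key m, Finset.sum_ite_eq]
  split_ifs with h
  · rfl
  · rw [MvPolynomial.homogeneousComponent_eq_zero _ _ (by simpa using h), map_zero]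

theorem isHomogeneous_x (i : ℕ) : (x i).IsHomogeneous 1 := MvPolynomial.isHomogeneous_X _ _

theorem isHomogeneous_t (i : ℕ) : (t i).IsHomogeneous 1 := MvPolynomial.isHomogeneous_X _ _

theorem isHomogeneous_omitT {f : Poly} {d : ℕ} (hf : f.IsHomogeneous d) (i : ℕ) :
    (omitT i f).IsHomogeneous d := by
  have := hf.aeval (n := 1) (Sum.elim x (fun j => if j < i then t j else t (j + 1))) (by
    rintro (j | j)
    · exact isHomogeneous_x j
    · simp only [Sum.elim_inr]; split_ifs <;> exact isHomogeneous_t _)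
  rwa [one_mul] at this

theorem homogeneousComponent_insT (i k n : ℕ) (f : Poly) :
    MvPolynomial.homogeneousComponent n (insT i k f) =
      insT i k (MvPolynomial.homogeneousComponent n f) := by
  refine homogeneousComponent_aeval ?_ n f
  rintro (j | j)
  · simp only [Sum.elim_inl]
    split_ifs
    · exact isHomogeneous_x _
    · exact isHomogeneous_t _
    · exact isHomogeneous_x _
  · exact isHomogeneous_t _

theorem IsDivDiff.homogeneousComponent {i k d : ℕ} {f g : Poly} (h : IsDivDiff i k f g)
    (hg : g.IsHomogeneous d) :
    IsDivDiff i k (MvPolynomial.homogeneousComponent (d + 1) f) g := by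
  rw [IsDivDiff, ← homogeneousComponent_insT, ← homogeneousComponent_insT, ← map_sub, h]
  refine MvPolynomial.homogeneousComponent_eq_self ?_
  rw [add_comm]
  exact ((isHomogeneous_x i).sub (isHomogeneous_t k)).mul hg

theorem ev_homogeneousComponent (σ : Equiv.Perm ℕ) (n : ℕ) (f : Poly) :
    ev σ (MvPolynomial.homogeneousComponent n f) =
      MvPolynomial.homogeneousComponent n (ev σ f) := by
  refine (homogeneousComponent_aeval ?_ n f).symm
  rintro (j | j) <;> exact MvPolynomial.isHomogeneous_X _ _

theorem insT_rename (i k : ℕ) (q : MvPolynomial ℕ ℤ) :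
    insT i k (MvPolynomial.rename Sum.inr q) = MvPolynomial.rename Sum.inr q := by
  suffices (insT i k).comp (MvPolynomial.rename Sum.inr) = MvPolynomial.rename Sum.inr from
    DFunLike.congr_fun this q
  refine MvPolynomial.algHom_ext fun j => ?_
  simp [insT, t]

theorem ev_rename (σ : Equiv.Perm ℕ) (q : MvPolynomial ℕ ℤ) :
    ev σ (MvPolynomial.rename Sum.inr q) = q := by
  rw [ev, MvPolynomial.aeval_rename]
  exact MvPolynomial.aeval_X_left_apply q

/-! ### Construction of the double forest polynomials -/

open Classical in
/-- The conditions on the polynomial `f` of degree `d + 1` with code `c`, where `q` gives the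
polynomials of degree `d`. -/
structure IsForestStep (d : ℕ) (q : (ℕ → ℕ) → Poly) (c : ℕ → ℕ) (f : Poly) : Prop where
  homogeneous : f.IsHomogeneous (d + 1)
  ev_one : ev 1 f = 0
  divided : ∀ i, IsDividedDifference i f
    (if i ∈ seqDes c then omitT i (q (trimSeq c i)) else 0)

open Classical in
/-- The double forest polynomials of degree `d`, indexed by codes. -/
noncomputable def forestPoly : ℕ → (ℕ → ℕ) → Poly
  | 0, _ => 1
  | d + 1, c => if h : ∃ f, IsForestStep d (forestPoly d) c f then h.choose else 0

theorem forestPoly_succ {d : ℕ} {c : ℕ → ℕ} (h : ∃ f, IsForestStep d (forestPoly d) c f) :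
    IsForestStep d (forestPoly d) c (forestPoly (d + 1) c) := by
  rw [forestPoly, dif_pos h]
  exact h.choose_spec

/-- The prescribed family is integrable because far apart trimmings commute and so do the omissions
of `t i` and `t j`, with the same shift of `j` to `j - 1`. Adjacent positions impose no condition.
Here `q'` supplies the polynomials of twice trimmed codes. -/
theorem exists_isForestStep {d : ℕ} {q : (ℕ → ℕ) → Poly} {c : ℕ → ℕ} {N : ℕ}
    (hN : ∀ i, N ≤ i → c i = 0)
    (hq : ∀ i ∈ seqDes c, (q (trimSeq c i)).IsHomogeneous d)
    {q' : (ℕ → ℕ) → Poly}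
    (hd : ∀ i ∈ seqDes c, ∀ j,
      (j ∈ seqDes (trimSeq c i) → IsDividedDifference j (q (trimSeq c i))
        (omitT j (q' (trimSeq (trimSeq c i) j)))) ∧
      (j ∉ seqDes (trimSeq c i) → IsDividedDifference j (q (trimSeq c i)) 0)) :
    ∃ f, IsForestStep d q c f := by
  classical
  obtain ⟨f, hf⟩ := exists_isDividedDifference
    (fun i => if i ∈ seqDes c then omitT i (q (trimSeq c i)) else 0) N
    (fun i hi => if_neg fun h => by have := h.1; rw [hN i hi] at this; omega)
    (fun i j hij => by
      refine ⟨if i ∈ seqDes c ∧ j ∈ seqDes c then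
        omitT j (omitT i (q' (trimSeq (trimSeq c j) i))) else 0, ?_, ?_⟩
      · by_cases hj : j ∈ seqDes c
        · have ht : omitT j (t i) = t i := by rw [omitT_t, if_pos (by omega)]
          simp only [hj, if_true, and_true]
          have := hd j hj i
          rw [mem_seqDes_trimSeq_of_lt hij] at this
          split_ifs with hi
          · exact IsDivDiff.omitT (this.1 hi) ht
          · have := IsDivDiff.omitT (this.2 hi) ht
            rwa [map_zero] at this
        · simp only [hj, and_false, if_false]
          exact isDivDiff_zero _ _
      · by_cases hi : i ∈ seqDes c
        · have ht : omitT i (t (j - 1)) = t j := by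
            rw [omitT_t, if_neg (by omega), Nat.sub_add_cancel (by omega)]
          simp only [hi, if_true, true_and]
          have := hd i hi (j - 1)
          rw [mem_seqDes_trimSeq_of_gt hij, ← trimSeq_trimSeq hij] at this
          split_ifs with hj
          · rw [omitT_comm (by omega)]
            exact IsDivDiff.omitT (this.1 hj) ht
          · have := IsDivDiff.omitT (this.2 hj) ht
            rwa [map_zero] at this
        · simp only [hi, false_and, if_false]
          exact isDivDiff_zero _ _)
  -- Subtracting the value at `x = t`, a polynomial in `t` alone, leaves the divided differences
  -- unchanged; so does the projection, since they are homogeneous of degree `d`.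
  refine ⟨MvPolynomial.homogeneousComponent (d + 1)
    (f - MvPolynomial.rename Sum.inr (ev 1 f)), ?_, ?_, fun i => ?_⟩
  · exact MvPolynomial.homogeneousComponent_isHomogeneous _ _
  · rw [ev_homogeneousComponent, map_sub, ev_rename, sub_self, map_zero]
  · refine IsDivDiff.homogeneousComponent ?_ ?_
    · have := hf i
      rw [isDividedDifference_iff] at this
      rw [IsDivDiff, map_sub, map_sub, insT_rename, insT_rename, sub_sub_sub_cancel_right]
      exact this
    · split_ifs with hi
      · exact isHomogeneous_omitT (hq i hi) i
      · exact MvPolynomial.isHomogeneous_zero _ _ _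

theorem forestPoly_spec (d : ℕ) : ∀ c, HasSize c d → (forestPoly d c).IsHomogeneous d ∧
    (d ≠ 0 → ev 1 (forestPoly d c) = 0) ∧
    ∀ i, (i ∈ seqDes c → IsDividedDifference i (forestPoly d c)
        (omitT i (forestPoly (d - 1) (trimSeq c i)))) ∧
      (i ∉ seqDes c → IsDividedDifference i (forestPoly d c) 0) := by
  induction d with
  | zero =>
    intro c hc
    obtain rfl := hc.eq_zero
    refine ⟨MvPolynomial.isHomogeneous_one _ _, fun h => absurd rfl h, fun i => ⟨fun h => ?_,
      fun _ => ?_⟩⟩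
    · exact absurd h.1 (by simp)
    · simp [IsDividedDifference, forestPoly]
  | succ d ih =>
    intro c hc
    rw [Nat.add_sub_cancel]
    obtain ⟨N, hN, -⟩ := id hc
    have h := forestPoly_succ (exists_isForestStep hN (fun i hi => (ih _ (hc.trimSeq hi)).1)
      (fun i hi => (ih _ (hc.trimSeq hi)).2.2))
    refine ⟨h.homogeneous, fun _ => h.ev_one, fun i => ⟨fun hi => ?_, fun hi => ?_⟩⟩
    · simpa only [if_pos hi] using h.divided i
    · simpa only [if_neg hi] using h.divided i

theorem IndexedForest.exists_hasSize (F : IndexedForest) : ∃ d, HasSize F.code d := by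
  obtain ⟨N, hN⟩ := F.exists_code_eq_zero
  exact ⟨_, N, hN, rfl⟩

theorem exists_isDoubleForestFamily : ∃ P, IsDoubleForestFamily P := by
  choose d hd using IndexedForest.exists_hasSize
  have hspec := fun F => forestPoly_spec (d F) F.code (hd F)
  refine ⟨fun F => forestPoly (d F) F.code, fun F => ⟨_, (hspec F).1⟩, ?_, ?_, ?_, ?_⟩
  · have h := hd .empty
    rw [IndexedForest.code_empty] at h
    rw [h.eq hasSize_zero]
    exact map_one _
  · intro F hF
    refine (hspec F).2.1 fun h => hF (F.eq_empty_of_code ?_)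
    have := hd F
    rw [h] at this
    exact this.eq_zero
  · intro F i hi
    have hi' := hi
    rw [F.qdes_eq] at hi'
    have h := ((hspec F).2.2 i).1 hi'
    have hpos : d F - 1 + 1 = d F := by
      refine Nat.sub_add_cancel (Nat.pos_of_ne_zero fun h0 => ?_)
      have h1 := hd F
      rw [h0] at h1
      have h2 := hi'.1
      rw [h1.eq_zero] at h2
      exact absurd h2 (by simp)
    have h1 := hd F
    rw [← hpos] at h1
    have h2 := hd (F.trim i)
    rw [F.code_trim hi] at h2
    rw [F.code_trim hi, h2.eq (h1.trimSeq hi')]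
    exact h
  · intro F i hi
    rw [F.qdes_eq] at hi
    exact ((hspec F).2.2 i).2 hi

/-! ### Uniqueness -/

/-- If `x j` is the last `x`-variable of `f` and `n ≤ j`, then `Rplus j` fixes `f`, whereas `Rminus
j` replaces `x j` by `t j` and so removes it. -/
theorem vars_lt_of_Rplus_eq {n : ℕ} {f : Poly} (hf : ∀ i, n ≤ i → Rplus i f = Rminus i f) :
    ∀ j, Sum.inl j ∈ f.vars → j < n := by
  classical
  by_contra! hcon
  obtain ⟨j, hj, hmax⟩ : ∃ j, (Sum.inl j ∈ f.vars ∧ n ≤ j) ∧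
      ∀ k, Sum.inl k ∈ f.vars → k ≤ j := by
    obtain ⟨j0, hj0, hn⟩ := hcon
    obtain ⟨j, hj, hmax⟩ := Set.exists_max_image (Sum.inl ⁻¹' (f.vars : Set (ℕ ⊕ ℕ))) id
      (f.vars.finite_toSet.preimage Sum.inl_injective.injOn) ⟨j0, hj0⟩
    exact ⟨j, ⟨hj, hn.trans (hmax j0 hj0)⟩, hmax⟩
  have h1 : Rplus j f = f := by
    conv_rhs => rw [← MvPolynomial.aeval_X_left_apply f]
    refine MvPolynomial.eval₂Hom_congr' rfl (fun k hk _ => ?_) rfl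
    rcases k with k | k
    · rw [Sum.elim_inl, if_pos (Nat.lt_succ_of_le (hmax k hk))]; rfl
    · rfl
  have h2 : Sum.inl j ∈ (Rminus j f).vars := by
    rw [← hf j hj.2, h1]; exact hj.1
  rw [Rminus, MvPolynomial.aeval_eq_bind₁] at h2
  obtain ⟨k, hk, hjk⟩ := MvPolynomial.mem_vars_bind₁ _ _ h2
  rcases k with k | k
  · have := hmax k hk
    simp only [Sum.elim_inl] at hjk
    split_ifs at hjk with h3 h4
    · simp [x, MvPolynomial.vars_X] at hjk; omega
    · simp [t, MvPolynomial.vars_X] at hjk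
    · omega
  · simp [t, MvPolynomial.vars_X] at hjk

theorem eq_zero_of_Rplus_eq {f : Poly} (hf : ∀ i, Rplus i f = Rminus i f) (h0 : ev 1 f = 0) :
    f = 0 := by
  have hv := vars_lt_of_Rplus_eq (n := 0) fun i _ => hf i
  have h : f = MvPolynomial.rename Sum.inr (ev 1 f) := by
    conv_lhs => rw [← MvPolynomial.aeval_X_left_apply f]
    change _ = ((MvPolynomial.rename Sum.inr).comp (ev 1)) f
    rw [MvPolynomial.aeval_unique ((MvPolynomial.rename Sum.inr).comp (ev 1))]
    refine MvPolynomial.eval₂Hom_congr' rfl (fun k hk _ => ?_) rfl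
    rcases k with k | k
    · exact absurd (hv k hk) (by omega)
    · simp [ev]
  rw [h, h0, map_zero]

theorem IsDividedDifference.sub_eq {i : ℕ} {f f' g : Poly} (h : IsDividedDifference i f g)
    (h' : IsDividedDifference i f' g) : Rplus i (f - f') = Rminus i (f - f') := by
  rw [← sub_eq_zero, map_sub, map_sub, sub_sub_sub_comm, h, h', sub_self]

/-- By induction on the size of the code the trimmed polynomials agree, so the difference of the two
candidates has zero divided differences and is zero at `x = t`. -/
theorem IsDoubleForestFamily.eq {P P' : IndexedForest → Poly} (h : IsDoubleForestFamily P)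
    (h' : IsDoubleForestFamily P') : P = P' := by
  have key : ∀ d F, HasSize F.code d → P F = P' F := by
    intro d
    induction d with
    | zero =>
      intro F hF
      obtain rfl := F.eq_empty_of_code hF.eq_zero
      refine sub_eq_zero.1 (eq_zero_of_Rplus_eq (fun i => ?_) ?_)
      · have hi : i ∉ IndexedForest.empty.qdes := by
          rw [IndexedForest.qdes_eq, IndexedForest.code_empty]
          exact fun h => absurd h.1 (by simp)
        exact (h.trim_notMem _ i hi).sub_eq (h'.trim_notMem _ i hi)
      · rw [map_sub, h.ev_empty, h'.ev_empty, sub_self]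
    | succ d ih =>
      intro F hF
      refine sub_eq_zero.1 (eq_zero_of_Rplus_eq (fun i => ?_) ?_)
      · by_cases hi : i ∈ F.qdes
        · have h1 := h.trim_mem F i hi
          rw [ih (F.trim i) (F.code_trim hi ▸ hF.trimSeq (F.qdes_eq ▸ hi))] at h1
          exact h1.sub_eq (h'.trim_mem F i hi)
        · exact (h.trim_notMem F i hi).sub_eq (h'.trim_notMem F i hi)
      · have hne : F ≠ .empty := by
          rintro rfl
          rw [IndexedForest.code_empty] at hF
          exact absurd (hF.eq hasSize_zero) (by omega)
        rw [map_sub, h.ev_of_ne F hne, h'.ev_of_ne F hne, sub_self]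
  funext F
  obtain ⟨d, hd⟩ := F.exists_hasSize
  exact key d F hd

/-! ### Vanishing at noncrossing permutations -/

/-- A descent of a padded code can only sit at `n - 1`. Zero divided differences at `i ≥ n` bound
the variables, and those at `i + 1 < n` are the quasisymmetry relations. -/
theorem IsDoubleForestFamily.mem_EQSym {P : IndexedForest → Poly} (h : IsDoubleForestFamily P)
    {n : ℕ} {F : IndexedForest} (hF : IsPadded n F.code) : P F ∈ EQSym n := by
  obtain ⟨k, -, hz, hpos, hn⟩ := hF
  have hR : ∀ i, i ∉ seqDes F.code → Rplus i (P F) = Rminus i (P F) := fun i hi => by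
    have := h.trim_notMem F i (F.qdes_eq ▸ hi)
    rw [IsDividedDifference, mul_zero] at this
    exact sub_eq_zero.1 this
  refine ⟨vars_lt_of_Rplus_eq fun i hi => hR i fun hdes => ?_, fun i hi => hR i fun hdes => ?_⟩
  · exact hdes.1.ne' (hn i hi)
  · have hk : k ≤ i := by
      by_contra hlt
      exact hdes.1.ne' (hz i (by omega))
    exact (hpos (i + 1) (by omega) hi).ne' hdes.2

theorem IsDoubleForestFamily.ev_eq_zero {P : IndexedForest → Poly}
    (h : IsDoubleForestFamily P) {n : ℕ} {F : IndexedForest} (hF : IsPadded n F.code)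
    (h0 : F.code ≠ 0) {σ : Equiv.Perm ℕ} (hσ : σ ∈ NC n) : ev σ (P F) = 0 := by
  rw [ev_eq_of_mem_NC (h.mem_EQSym hF) hσ]
  refine h.ev_of_ne F ?_
  rintro rfl
  exact h0 IndexedForest.code_empty

end EQSymNC

open EQSymNC in
theorem theorem7p1 :
    (∀ (n : ℕ) (f : Poly) (σ : Equiv.Perm ℕ), f ∈ EQSym n → σ ∈ NC n → ev σ f = ev 1 f) ∧
    (∃! P : IndexedForest → Poly, IsDoubleForestFamily P) ∧
    (∀ P : IndexedForest → Poly, IsDoubleForestFamily P →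
      ∀ (n : ℕ) (c : ℕ → ℕ), IsPadded n c → c ≠ 0 →
        ∀ F : IndexedForest, F.code = c → ∀ σ ∈ NC n, ev σ (P F) = 0) ∧
    (∀ n : ℕ, NC n = {σ | Relation.EqvGen (NCStep n) 1 σ}) := by
  refine ⟨fun n f σ hf hσ => ev_eq_of_mem_NC hf hσ, ?_, ?_, NC_eq_eqvGen⟩
  · obtain ⟨P, hP⟩ := exists_isDoubleForestFamily
    exact ⟨P, hP, fun P' hP' => hP'.eq hP⟩
  · rintro P hP n c hc h0 F rfl σ hσ
    exact hP.ev_eq_zero hc h0 hσ
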